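/- Let $A\in\mathbb{R}^{n\times n}$, $B\in\mathbb{R}^{n\times m}$, $C\in\mathbb{R}^{d\times n}$, let $Q\in\mathbb{R}^{n\times n}$ be symmetric positive semidefinite and $R\in\mathbb{R}^{m\times m}$ symmetric positive definite, and suppose that $(A,B)$ is controllable, that $(C,A)$ and $(Q^{1/2},A)$ are observable, and that $C$ has full row rank. A controller is a triple $\mathsf K=(A_{\mathsf K},B_{\mathsf K},C_{\mathsf K})\in\mathbb{R}^{n\times n}\times\mathbb{R}^{n\times d}\times\mathbb{R}^{m\times n}$; in feedback with the system it gives $$x_{t+1}=Ax_t+Bu_t,\quad y_t=Cx_t,\quad \xi_{t+1}=A_{\mathsf K}\xi_t+B_{\mathsf K}y_t,\quad u_t=C_{\mathsf K}\xi_t .$$ It is stabilizing, $\mathsf K\in\mathbb K$, if the closed-loop matrix $\begin{bmatrix}A&BC_{\mathsf K}\\ B_{\mathsf K}C&A_{\mathsf K}\end{bmatrix}$ has spectral radius less than $1$, and observable, $\mathsf K\in\mathbb K_o$, if $(C_{\mathsf K},A_{\mathsf K})$ is observable. Let $(x_0,\xi_0)$ be distributed according to a fixed probability distribution $\bar{\mathcal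 D}$ on $\mathbb{R}^n\times\mathbb{R}^n$ with finite second moments, whose second moment matrix $X=\mathbb E\begin{bmatrix}x_0\\ \xi_0\end{bmatrix}\begin{bmatrix}x_0\\ \xi_0\end{bmatrix}^{\mathsf T}$ is positive definite. The dLQR problem is to minimize $$J(\mathsf K)=\mathbb E_{(x_0,\xi_0)\sim\bar{\mathcal D}}\Big[\sum_{t=0}^\infty\big(x_t^{\mathsf T}Qx_t+u_t^{\mathsf T}Ru_t\big)\Big]$$ over $\mathsf K\in\mathbb K$. Its set of stationary points is $\mathbb K_s=\{\mathsf K\in\mathbb K:\nabla J(\mathsf K)=0\}$, where $\nabla J$ is the gradient with respect to the entries of $(A_{\mathsf K},B_{\mathsf K},C_{\mathsf K})$. Suppose that the dLQR problem has a globally optimal controller that is observable. Let $(\mathsf K_i)_{i\ge 0}$ be iterates of a policy gradient algorithm $\mathsf K_{i+1}=\mathsf K_i-\alpha_i\nabla J(\mathsf K_i)$ with learning rates $\alpha_i\in\mathbb{R}$, and suppose that they converge to a point $\mathsf K\in\mathbb K_s$. If $\mathsf K\in\mathbb K_o$, then $\mathsf K$ is globally optimal, that is, $J(\mathsf K)\le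 J(\mathsf K')$ for all $\mathsf K'\in\mathbb K$. -/

import Mathlib

open MeasureTheory Filter Topology

/-- `(C, A)` is observable: the observability matrix with block rows `C * A ^ k`,
`k = 0, …, n - 1`, has rank `n`. -/
def IsObservablePair {n p : ℕ} (C : Matrix (Fin p) (Fin n) ℝ) (A : Matrix (Fin n) (Fin n) ℝ) :
    Prop :=
  (Matrix.of fun (r : Fin n × Fin p) (j : Fin n) => (C * A ^ (r.1 : ℕ)) r.2 j).rank = n

/-- `(A, B)` is controllable: the controllability matrix with block columns `A ^ k * B`,
`k = 0, …, n - 1`, has rank `n`. -/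
def IsControllablePair {n m : ℕ} (A : Matrix (Fin n) (Fin n) ℝ) (B : Matrix (Fin n) (Fin m) ℝ) :
    Prop :=
  (Matrix.of fun (i : Fin n) (c : Fin n × Fin m) => (A ^ (c.1 : ℕ) * B) i c.2).rank = n

open scoped MatrixOrder in
/-- The positive semidefinite square root `Q ^ (1/2)` of a positive semidefinite matrix. -/
noncomputable def psdSqrt {n : ℕ} (Q : Matrix (Fin n) (Fin n) ℝ) : Matrix (Fin n) (Fin n) ℝ :=
  CFC.sqrt Q

/-- The data of a linear quadratic control problem: the system `x⁺ = A x + B u`, `y = C x`,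
and the weights `Q`, `R` of the stage cost `xᵀ Q x + uᵀ R u`. -/
structure LQData (n m d : ℕ) where
  A : Matrix (Fin n) (Fin n) ℝ
  B : Matrix (Fin n) (Fin m) ℝ
  C : Matrix (Fin d) (Fin n) ℝ
  Q : Matrix (Fin n) (Fin n) ℝ
  R : Matrix (Fin m) (Fin m) ℝ

/-- Controller parameters `(A_K, B_K, C_K)` of the full-order dynamic controller
`ξ⁺ = A_K ξ + B_K y`, `u = C_K ξ`. -/
abbrev Controller (n m d : ℕ) : Type :=
  Matrix (Fin n) (Fin n) ℝ × Matrix (Fin n) (Fin d) ℝ × Matrix (Fin m) (Fin n) ℝ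

namespace Controller

variable {n m d : ℕ}

/-- The state matrix `A_K`. -/
abbrev AK (K : Controller n m d) : Matrix (Fin n) (Fin n) ℝ := K.1

/-- The input matrix `B_K`. -/
abbrev BK (K : Controller n m d) : Matrix (Fin n) (Fin d) ℝ := K.2.1

/-- The output matrix `C_K`. -/
abbrev CK (K : Controller n m d) : Matrix (Fin m) (Fin n) ℝ := K.2.2

end Controller

/-- The set of observable controllers. -/
def observableControllers (n m d : ℕ) : Set (Controller n m d) :=
  {K | IsObservablePair K.CK K.AK}

/-- The second moment matrix `X` of the random vector `(x₀, ξ₀)` with law `μ`. -/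
noncomputable def secondMoment {n : ℕ} (μ : Measure ((Fin n → ℝ) × (Fin n → ℝ))) :
    Matrix (Fin n ⊕ Fin n) (Fin n ⊕ Fin n) ℝ :=
  Matrix.of fun i j => ∫ z, Sum.elim z.1 z.2 i * Sum.elim z.1 z.2 j ∂μ

namespace LQData

variable {n m d : ℕ}

/-- The trajectory `t ↦ (x_t, ξ_t)` of the plant in feedback with the controller `K`, started at
`z = (x₀, ξ₀)`: `x⁺ = A x + B u`, `y = C x`, `ξ⁺ = A_K ξ + B_K y`, `u = C_K ξ`. -/
def traj (S : LQData n m d) (K : Controller n m d) (z : (Fin n → ℝ) × (Fin n → ℝ)) :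
    ℕ → (Fin n → ℝ) × (Fin n → ℝ)
  | 0 => z
  | t + 1 =>
    let x := (traj S K z t).1
    let ξ := (traj S K z t).2
    let y := S.C.mulVec x
    let u := K.CK.mulVec ξ
    (S.A.mulVec x + S.B.mulVec u, K.AK.mulVec ξ + K.BK.mulVec y)

/-- The stage cost `xᵀ Q x + uᵀ R u` in the state `z = (x, ξ)`, where `u = C_K ξ`. -/
def stageCost (S : LQData n m d) (K : Controller n m d) (z : (Fin n → ℝ) × (Fin n → ℝ)) : ℝ :=
  z.1 ⬝ᵥ S.Q.mulVec z.1 + K.CK.mulVec z.2 ⬝ᵥ S.R.mulVec (K.CK.mulVec z.2)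

/-- The `dLQR` cost: the expected accumulated cost, for `(x₀, ξ₀)` distributed according to `μ`.
It is meaningful on `S.stabilizing`. -/
noncomputable def cost (S : LQData n m d) (μ : Measure ((Fin n → ℝ) × (Fin n → ℝ)))
    (K : Controller n m d) : ℝ :=
  ∫ z, ∑' t : ℕ, S.stageCost K (S.traj K z t) ∂μ

/-- The closed-loop matrix acting on `(x, ξ)`. -/
def closedLoop (S : LQData n m d) (K : Controller n m d) :
    Matrix (Fin n ⊕ Fin n) (Fin n ⊕ Fin n) ℝ :=
  Matrix.fromBlocks S.A (S.B * K.CK) (K.BK * S.C) K.AK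

/-- The set of stabilizing controllers: the spectral radius of the closed-loop matrix
(the largest modulus of its complex eigenvalues) is less than one. -/
def stabilizing (S : LQData n m d) : Set (Controller n m d) :=
  {K | spectralRadius ℂ ((S.closedLoop K).map (algebraMap ℝ ℂ)) < 1}

/-- The gradient of the cost: the triple of matrices of partial derivatives of the cost with
respect to the entries of `A_K`, `B_K` and `C_K`. -/
noncomputable def gradCost (S : LQData n m d) (μ : Measure ((Fin n → ℝ) × (Fin n → ℝ)))
    (K : Controller n m d) : Controller n m d :=
  (Matrix.of fun i j => deriv (fun s : ℝ => S.cost μ (K + s • (Matrix.single i j 1, 0, 0))) 0,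
   Matrix.of fun i j => deriv (fun s : ℝ => S.cost μ (K + s • (0, Matrix.single i j 1, 0))) 0,
   Matrix.of fun i j => deriv (fun s : ℝ => S.cost μ (K + s • (0, 0, Matrix.single i j 1))) 0)

/-- The set of stationary points of the `dLQR` problem: the controllers in the domain
`S.stabilizing` of the cost at which its gradient vanishes. -/
def stationary (S : LQData n m d) (μ : Measure ((Fin n → ℝ) × (Fin n → ℝ))) :
    Set (Controller n m d) :=
  {K | K ∈ S.stabilizing ∧ S.gradCost μ K = 0}

/-- `K` is a globally optimal controller: it minimizes the cost over the stabilizing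
controllers. -/
def IsGloballyOptimal (S : LQData n m d) (μ : Measure ((Fin n → ℝ) × (Fin n → ℝ)))
    (K : Controller n m d) : Prop :=
  K ∈ S.stabilizing ∧ ∀ K' ∈ S.stabilizing, S.cost μ K ≤ S.cost μ K'

end LQData

section

open scoped Matrix

/-! There is at most one controller that is both stationary and observable
(`stationary_observable_unique`). A global optimum is stationary because it minimizes over an open
set, so the observable optimum and the observable limit point coincide.

For uniqueness, the cost is the trace of `P * X`, where `P` solves the Lyapunov equation of the
closed loop, and its derivative pairs `P` with the accumulated state moment `YY`
(`hasDerivAt_cost`). Observability makes the lower right block of `P` definite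
(`costMatrix_toBlocks₂₂_posDef`), and `X > 0` makes `YY` definite. Completing squares gives a matrix
`T` and Schur complement `Pi` from `P`, and a matrix `G` and Schur complement `Y` from `YY`.
Stationarity then forces `T * G = 1` and turns the controller into an observer with state feedback,
whose gains come from a control and a filter Riccati equation (`exists_isObserverBased`).

Stabilizing Riccati solutions are unique (`Pi_unique`, `Y_unique`). The remaining freedom is the
choice of state coordinates of the controller, and the initial correlation of plant and controller
states removes it: `G * X₂₂ = X₁₂` with `X₂₂` invertible determines `G`. -/

theorem Matrix.eq_zero_of_eq_mul_mul {l n : Type*} [Fintype l] [Fintype n] [DecidableEq l]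
    [DecidableEq n] {E : Matrix l l ℝ} {F : Matrix n n ℝ} {D : Matrix l n ℝ}
    (hE : Tendsto (fun t : ℕ => E ^ t) atTop (𝓝 0)) (hF : Tendsto (fun t : ℕ => F ^ t) atTop (𝓝 0))
    (h : D = E * D * F) : D = 0 := by
  have h1 : ∀ t : ℕ, D = E ^ t * D * F ^ t := by
    intro t
    induction t with
    | zero => simp
    | succ t ih =>
      conv_lhs => rw [ih, h]
      rw [pow_succ E, pow_succ' F]
      simp only [Matrix.mul_assoc]
  have hc : Continuous fun p : Matrix l l ℝ × Matrix n n ℝ => p.1 * D * p.2 :=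
    (continuous_fst.matrix_mul continuous_const).matrix_mul continuous_snd
  have h2 : Tendsto (fun t : ℕ => E ^ t * D * F ^ t) atTop (𝓝 0) := by
    have h3 := (hc.tendsto (0, 0)).comp (hE.prodMk_nhds hF)
    simpa only [Matrix.mul_zero, Function.comp_def] using h3
  exact tendsto_nhds_unique (tendsto_const_nhds.congr h1) h2

/-! ### Powers of stable matrices and Lyapunov equations. -/

section MatrixPowers

open scoped Matrix.Norms.Frobenius ENNReal Matrix

variable {ι : Type*} [Fintype ι] [DecidableEq ι]

/-- Spectral radii live over `ℂ` and all estimates over `ℝ`; the Frobenius norm sees only absolute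
values of entries, so it carries bounds between the two. -/
theorem Matrix.frobenius_norm_map_algebraMap_pow (M : Matrix ι ι ℝ) (t : ℕ) :
    ‖(M.map (algebraMap ℝ ℂ)) ^ t‖ = ‖M ^ t‖ := by
  rw [show (M.map (algebraMap ℝ ℂ)) ^ t = (M ^ t).map (algebraMap ℝ ℂ) from
    (map_pow (algebraMap ℝ ℂ).mapMatrix M t).symm]
  exact Matrix.frobenius_norm_map_eq _ _ fun a => by simp

/-- Gelfand's formula: for `r` strictly between the spectral radius and 1, eventually `‖M ^ t‖ < r ^
t`. -/
theorem Matrix.summable_norm_pow_of_spectralRadius_lt_one {M : Matrix ι ι ℝ}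
    (h : spectralRadius ℂ (M.map (algebraMap ℝ ℂ)) < 1) : Summable fun t : ℕ => ‖M ^ t‖ := by
  have : CompleteSpace (Matrix ι ι ℂ) := FiniteDimensional.complete ℂ _
  obtain ⟨r, hr, hr1⟩ := ENNReal.lt_iff_exists_nnreal_btwn.1 h
  have hr1' : r < 1 := by exact_mod_cast hr1
  have hG := (spectrum.pow_nnnorm_pow_one_div_tendsto_nhds_spectralRadius
    (M.map (algebraMap ℝ ℂ))).eventually_lt_const hr
  refine Summable.of_norm_bounded_eventually_nat
    (summable_geometric_of_lt_one r.coe_nonneg (by exact_mod_cast hr1')) ?_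
  filter_upwards [hG, eventually_gt_atTop 0] with t ht ht0
  have ht0' : (0 : ℝ) < t := by exact_mod_cast ht0
  have h1 := ENNReal.rpow_le_rpow ht.le ht0'.le
  rw [← ENNReal.rpow_mul, one_div, inv_mul_cancel₀ ht0'.ne', ENNReal.rpow_one,
    ENNReal.rpow_natCast] at h1
  rw [norm_norm, ← Matrix.frobenius_norm_map_algebraMap_pow]
  exact_mod_cast h1

/-- A single power of small norm already bounds the spectral radius below one, and smallness of that
power is an open condition. The factor `‖1‖` is needed because the Frobenius norm of the identity
need not be 1. -/
theorem Matrix.eventually_spectralRadius_lt_one {M : Matrix ι ι ℝ}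
    (h : spectralRadius ℂ (M.map (algebraMap ℝ ℂ)) < 1) :
    ∀ᶠ N in 𝓝 M, spectralRadius ℂ (N.map (algebraMap ℝ ℂ)) < 1 := by
  have : CompleteSpace (Matrix ι ι ℂ) := FiniteDimensional.complete ℂ _
  have h0 := (Matrix.summable_norm_pow_of_spectralRadius_lt_one h).tendsto_atTop_zero
  have h1 : Tendsto (fun t : ℕ => ‖M ^ (t + 1)‖ * ‖(1 : Matrix ι ι ℂ)‖) atTop (𝓝 0) := by
    simpa using ((tendsto_add_atTop_iff_nat 1).2 h0).mul_const ‖(1 : Matrix ι ι ℂ)‖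
  obtain ⟨k, hk⟩ := (h1.eventually_lt_const one_pos).exists
  have hc : Continuous fun N : Matrix ι ι ℝ => ‖N ^ (k + 1)‖ * ‖(1 : Matrix ι ι ℂ)‖ := by fun_prop
  filter_upwards [hc.continuousAt.eventually_lt_const hk] with N hN
  refine (spectrum.spectralRadius_le_pow_nnnorm_pow_one_div ℂ _ k).trans_lt ?_
  rw [← ENNReal.mul_rpow_of_nonneg _ _ (by positivity)]
  refine ENNReal.rpow_lt_one ?_ (by positivity)
  rw [← Matrix.frobenius_norm_map_algebraMap_pow] at hN
  exact_mod_cast hN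

theorem Matrix.tendsto_pow_zero_of_summable_norm {M : Matrix ι ι ℝ}
    (h : Summable fun t : ℕ => ‖M ^ t‖) : Tendsto (fun t : ℕ => M ^ t) atTop (𝓝 0) :=
  tendsto_zero_iff_norm_tendsto_zero.2 h.tendsto_atTop_zero

theorem Summable.norm_pow_mul_norm_pow {M : Matrix ι ι ℝ} (h : Summable fun t : ℕ => ‖M ^ t‖) :
    Summable fun t : ℕ => ‖M ^ t‖ * ‖M ^ t‖ :=
  Summable.of_nonneg_of_le (fun t => by positivity)
    (fun t => mul_le_mul_of_nonneg_right (h.le_tsum t fun _ _ => norm_nonneg _) (norm_nonneg _))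
    (h.mul_left (∑' t : ℕ, ‖M ^ t‖))

theorem Summable.transpose_norm_pow {M : Matrix ι ι ℝ} (h : Summable fun t : ℕ => ‖M ^ t‖) :
    Summable fun t : ℕ => ‖Mᵀ ^ t‖ := by
  simpa only [← Matrix.transpose_pow, Matrix.frobenius_norm_transpose] using h

/-- The solution `∑ (Mᵀ) ^ t * W * M ^ t` of the Lyapunov equation `P = W + Mᵀ * P * M`. -/
noncomputable def lyapunovSum (M W : Matrix ι ι ℝ) : Matrix ι ι ℝ :=
  ∑' t : ℕ, (Mᵀ) ^ t * W * M ^ t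

theorem norm_lyapunov_term_le (M W : Matrix ι ι ℝ) (t : ℕ) :
    ‖(Mᵀ) ^ t * W * M ^ t‖ ≤ ‖M ^ t‖ * ‖M ^ t‖ * ‖W‖ := by
  calc _ ≤ ‖(Mᵀ) ^ t‖ * ‖W‖ * ‖M ^ t‖ :=
        (norm_mul_le _ _).trans (mul_le_mul_of_nonneg_right (norm_mul_le _ _) (norm_nonneg _))
    _ = _ := by rw [← Matrix.transpose_pow, Matrix.frobenius_norm_transpose]; ring

variable {M : Matrix ι ι ℝ}

theorem summable_lyapunov (h : Summable fun t : ℕ => ‖M ^ t‖) (W : Matrix ι ι ℝ) :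
    Summable fun t : ℕ => (Mᵀ) ^ t * W * M ^ t := by
  have : CompleteSpace (Matrix ι ι ℝ) := FiniteDimensional.complete ℝ _
  exact Summable.of_norm_bounded (h.norm_pow_mul_norm_pow.mul_right ‖W‖) (norm_lyapunov_term_le M W)

theorem norm_lyapunovSum_le (h : Summable fun t : ℕ => ‖M ^ t‖) (W : Matrix ι ι ℝ) :
    ‖lyapunovSum M W‖ ≤ (∑' t : ℕ, ‖M ^ t‖ * ‖M ^ t‖) * ‖W‖ := by
  rw [← tsum_mul_right]
  exact tsum_of_norm_bounded (h.norm_pow_mul_norm_pow.mul_right ‖W‖).hasSum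
    (norm_lyapunov_term_le M W)

theorem lyapunovSum_eq (h : Summable fun t : ℕ => ‖M ^ t‖) (W : Matrix ι ι ℝ) :
    lyapunovSum M W = W + Mᵀ * lyapunovSum M W * M := by
  have hs := summable_lyapunov h W
  conv_lhs => rw [lyapunovSum, hs.tsum_eq_zero_add]
  rw [lyapunovSum, ← hs.tsum_mul_left, ← (hs.mul_left Mᵀ).tsum_mul_right]
  simp only [pow_zero, one_mul, mul_one]
  congr 2
  ext1 t
  rw [pow_succ' Mᵀ, pow_succ M]
  simp only [mul_assoc]

theorem lyapunovSum_unique (h : Summable fun t : ℕ => ‖M ^ t‖) {W P : Matrix ι ι ℝ}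
    (hP : P = W + Mᵀ * P * M) : P = lyapunovSum M W := by
  rw [← sub_eq_zero]
  refine Matrix.eq_zero_of_eq_mul_mul
    (Matrix.tendsto_pow_zero_of_summable_norm h.transpose_norm_pow)
    (Matrix.tendsto_pow_zero_of_summable_norm h) ?_
  conv_lhs => rw [hP, lyapunovSum_eq h W]
  simp only [mul_sub, sub_mul]
  abel

theorem lyapunovSum_transpose (h : Summable fun t : ℕ => ‖M ^ t‖) {W : Matrix ι ι ℝ}
    (hW : Wᵀ = W) : (lyapunovSum M W)ᵀ = lyapunovSum M W := by
  refine lyapunovSum_unique h ?_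
  conv_lhs => rw [lyapunovSum_eq h W]
  simp only [Matrix.transpose_add, Matrix.transpose_mul, Matrix.transpose_transpose, hW,
    Matrix.mul_assoc]

theorem lyapunovSum_posSemidef (h : Summable fun t : ℕ => ‖M ^ t‖) {W : Matrix ι ι ℝ}
    (hW : W.PosSemidef) : (lyapunovSum M W).PosSemidef := by
  refine Matrix.PosSemidef.of_dotProduct_mulVec_nonneg ?_ fun x => ?_
  · have := lyapunovSum_transpose h (W := W) (by simpa using hW.isHermitian.eq)
    simpa [Matrix.IsHermitian] using this
  · have hc : Continuous fun N : Matrix ι ι ℝ => star x ⬝ᵥ N *ᵥ x :=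
      continuous_const.dotProduct (continuous_id.matrix_mulVec continuous_const)
    have hs := ((summable_lyapunov h W).hasSum.map
      (AddMonoidHom.mk' (fun N : Matrix ι ι ℝ => star x ⬝ᵥ N *ᵥ x)
        fun a b => by simp [Matrix.add_mulVec]) hc)
    refine hs.nonneg fun t => ?_
    have := (hW.conjTranspose_mul_mul_same (M ^ t)).dotProduct_mulVec_nonneg x
    simpa [Matrix.transpose_pow] using this

/-- The perturbation `P - P₀` solves a Lyapunov equation for the fixed matrix `M`, with a source
made of `V s - W` and terms of size `‖N s - M‖ * ‖P‖`. Hence no uniform bound on the powers of `N s`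
is needed. -/
theorem tendsto_lyapunovSum {α : Type*} {l : Filter α} {N : α → Matrix ι ι ℝ}
    {V : α → Matrix ι ι ℝ} {W : Matrix ι ι ℝ} (hN : Tendsto N l (𝓝 M)) (hV : Tendsto V l (𝓝 W))
    (h : Summable fun t : ℕ => ‖M ^ t‖) (hs : ∀ᶠ s in l, Summable fun t : ℕ => ‖N s ^ t‖) :
    Tendsto (fun s => lyapunovSum (N s) (V s)) l (𝓝 (lyapunovSum M W)) := by
  set c := ∑' t : ℕ, ‖M ^ t‖ * ‖M ^ t‖ with hc
  have hc0 : 0 ≤ c := tsum_nonneg fun t => by positivity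
  set ε : α → ℝ := fun s => c * (‖N s - M‖ * ‖N s‖ + ‖M‖ * ‖N s - M‖) with hε
  have hd : Tendsto (fun s => ‖N s - M‖) l (𝓝 0) := tendsto_iff_norm_sub_tendsto_zero.1 hN
  have hε0 : Tendsto ε l (𝓝 0) := by
    simpa using ((hd.mul hN.norm).add (hd.const_mul ‖M‖)).const_mul c
  have hV0 : Tendsto (fun s => ‖V s - W‖) l (𝓝 0) := tendsto_iff_norm_sub_tendsto_zero.1 hV
  refine tendsto_iff_norm_sub_tendsto_zero.2 ?_
  have hlim : Tendsto (fun s => 2 * (c * ‖V s - W‖ + ε s * ‖lyapunovSum M W‖)) l (𝓝 0) := by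
    simpa using ((hV0.const_mul c).add (hε0.mul_const ‖lyapunovSum M W‖)).const_mul 2
  refine squeeze_zero' (Eventually.of_forall fun s => norm_nonneg _) ?_ hlim
  -- With `ε s < 1 / 2`, the term `ε s * ‖P - P₀‖` is absorbed into the left side; this costs the
  -- factor 2 in `hlim`.
  filter_upwards [hs, hε0.eventually_lt_const (show (0 : ℝ) < 1 / 2 by norm_num)] with s hs hεs
  set P := lyapunovSum (N s) (V s) with hP
  set P₀ := lyapunovSum M W with hP₀
  have hPe : P = V s + (N s)ᵀ * P * N s := lyapunovSum_eq hs _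
  have hP₀e : P₀ = W + Mᵀ * P₀ * M := lyapunovSum_eq h _
  have hΔ : P - P₀ = lyapunovSum M
      ((V s - W) + ((N s - M)ᵀ * P * N s + Mᵀ * P * (N s - M))) := by
    refine lyapunovSum_unique h ?_
    conv_lhs => rw [hPe, hP₀e]
    simp only [mul_sub, sub_mul, Matrix.transpose_sub]
    abel
  have hb : ‖(N s - M)ᵀ * P * N s + Mᵀ * P * (N s - M)‖ ≤
      (‖N s - M‖ * ‖N s‖ + ‖M‖ * ‖N s - M‖) * ‖P‖ := by
    refine (norm_add_le _ _).trans ?_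
    have h1 : ‖(N s - M)ᵀ * P * N s‖ ≤ ‖N s - M‖ * ‖P‖ * ‖N s‖ := by
      rw [← Matrix.frobenius_norm_transpose (N s - M)]
      exact (norm_mul_le _ _).trans (mul_le_mul_of_nonneg_right (norm_mul_le _ _) (norm_nonneg _))
    have h2 : ‖Mᵀ * P * (N s - M)‖ ≤ ‖M‖ * ‖P‖ * ‖N s - M‖ := by
      rw [← Matrix.frobenius_norm_transpose M]
      exact (norm_mul_le _ _).trans (mul_le_mul_of_nonneg_right (norm_mul_le _ _) (norm_nonneg _))
    linarith
  have h1 : ‖P - P₀‖ ≤ c * ‖V s - W‖ + ε s * ‖P‖ := by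
    calc ‖P - P₀‖ ≤ c * ‖(V s - W) + ((N s - M)ᵀ * P * N s + Mᵀ * P * (N s - M))‖ := by
          conv_lhs => rw [hΔ]
          exact norm_lyapunovSum_le h _
      _ ≤ c * (‖V s - W‖ + (‖N s - M‖ * ‖N s‖ + ‖M‖ * ‖N s - M‖) * ‖P‖) :=
          mul_le_mul_of_nonneg_left ((norm_add_le _ _).trans (by gcongr)) hc0
      _ = _ := by rw [hε]; ring
  have h2 : ‖P‖ ≤ ‖P - P₀‖ + ‖P₀‖ := by simpa using norm_add_le (P - P₀) P₀
  have hεn : 0 ≤ ε s := by positivity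
  nlinarith [mul_le_mul_of_nonneg_left h2 hεn, mul_le_mul_of_nonneg_right hεs.le
    (norm_nonneg (P - P₀))]

end MatrixPowers

/-! ### The cost as a trace, and its directional derivatives. -/

namespace LQData

variable {n m d : ℕ}

/-- The matrix of the stage cost as a quadratic form in `(x, ξ)`. -/
def stageMatrix (S : LQData n m d) (K : Controller n m d) :
    Matrix (Fin n ⊕ Fin n) (Fin n ⊕ Fin n) ℝ :=
  Matrix.fromBlocks S.Q 0 0 (K.CKᵀ * S.R * K.CK)

/-- The matrix of the accumulated cost as a quadratic form in `(x₀, ξ₀)`. -/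
noncomputable def costMatrix (S : LQData n m d) (K : Controller n m d) :
    Matrix (Fin n ⊕ Fin n) (Fin n ⊕ Fin n) ℝ :=
  lyapunovSum (S.closedLoop K) (S.stageMatrix K)

/-- The sum over time of the second moment matrices of the closed-loop state. -/
noncomputable def stateMoment (S : LQData n m d) (K : Controller n m d)
    (X : Matrix (Fin n ⊕ Fin n) (Fin n ⊕ Fin n) ℝ) : Matrix (Fin n ⊕ Fin n) (Fin n ⊕ Fin n) ℝ :=
  lyapunovSum (S.closedLoop K)ᵀ X

theorem sumElim_traj (S : LQData n m d) (K : Controller n m d) (z : (Fin n → ℝ) × (Fin n → ℝ))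
    (t : ℕ) : Sum.elim (S.traj K z t).1 (S.traj K z t).2 =
      (S.closedLoop K ^ t) *ᵥ Sum.elim z.1 z.2 := by
  induction t with
  | zero => simp [traj]
  | succ t ih =>
    rw [pow_succ', ← Matrix.mulVec_mulVec, ← ih, closedLoop, Matrix.fromBlocks_mulVec]
    simp [traj, Matrix.mulVec_mulVec, add_comm]

theorem stageCost_eq (S : LQData n m d) (K : Controller n m d) (z : (Fin n → ℝ) × (Fin n → ℝ)) :
    S.stageCost K z = Sum.elim z.1 z.2 ⬝ᵥ S.stageMatrix K *ᵥ Sum.elim z.1 z.2 := by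
  rw [stageMatrix, Matrix.fromBlocks_mulVec, sumElim_dotProduct_sumElim, stageCost]
  simp only [Sum.elim_comp_inl, Sum.elim_comp_inr, Matrix.zero_mulVec, add_zero, zero_add]
  rw [Matrix.mul_assoc, ← Matrix.mulVec_mulVec, ← Matrix.mulVec_mulVec,
    Matrix.dotProduct_mulVec _ K.CKᵀ, Matrix.vecMul_transpose]

open scoped Matrix.Norms.Frobenius in
theorem summable_norm_closedLoop_pow {S : LQData n m d} {K : Controller n m d}
    (hK : K ∈ S.stabilizing) : Summable fun t : ℕ => ‖S.closedLoop K ^ t‖ :=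
  Matrix.summable_norm_pow_of_spectralRadius_lt_one hK

theorem tendsto_closedLoop_pow {S : LQData n m d} {K : Controller n m d}
    (hK : K ∈ S.stabilizing) : Tendsto (fun t : ℕ => S.closedLoop K ^ t) atTop (𝓝 0) :=
  Matrix.tendsto_pow_zero_of_summable_norm (summable_norm_closedLoop_pow hK)

theorem costMatrix_eq {S : LQData n m d} {K : Controller n m d} (hK : K ∈ S.stabilizing) :
    S.costMatrix K = S.stageMatrix K + (S.closedLoop K)ᵀ * S.costMatrix K * S.closedLoop K :=
  lyapunovSum_eq (summable_norm_closedLoop_pow hK) _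

theorem stateMoment_eq {S : LQData n m d} {K : Controller n m d} (hK : K ∈ S.stabilizing)
    (X : Matrix (Fin n ⊕ Fin n) (Fin n ⊕ Fin n) ℝ) :
    S.stateMoment K X = X + S.closedLoop K * S.stateMoment K X * (S.closedLoop K)ᵀ := by
  have := lyapunovSum_eq (summable_norm_closedLoop_pow hK).transpose_norm_pow X
  rwa [Matrix.transpose_transpose] at this

theorem stageMatrix_posSemidef {S : LQData n m d} (hQ : S.Q.PosSemidef) (hR : S.R.PosDef)
    (K : Controller n m d) : (S.stageMatrix K).PosSemidef := by
  have h1 : (K.CKᵀ * S.R * K.CK).PosSemidef := by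
    simpa using hR.posSemidef.conjTranspose_mul_mul_same K.CK
  refine Matrix.PosSemidef.of_dotProduct_mulVec_nonneg ?_ fun x => ?_
  · exact Matrix.IsHermitian.fromBlocks hQ.isHermitian (by simp) h1.isHermitian
  · obtain ⟨u, v, rfl⟩ : ∃ u v : Fin n → ℝ, x = Sum.elim u v :=
      ⟨x ∘ Sum.inl, x ∘ Sum.inr, (Sum.elim_comp_inl_inr x).symm⟩
    rw [stageMatrix, Matrix.fromBlocks_mulVec, star_trivial, sumElim_dotProduct_sumElim]
    have h2 := hQ.dotProduct_mulVec_nonneg u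
    have h3 := h1.dotProduct_mulVec_nonneg v
    simp only [star_trivial] at h2 h3
    simpa using add_nonneg h2 h3

theorem costMatrix_posSemidef {S : LQData n m d} (hQ : S.Q.PosSemidef) (hR : S.R.PosDef)
    {K : Controller n m d} (hK : K ∈ S.stabilizing) : (S.costMatrix K).PosSemidef :=
  lyapunovSum_posSemidef (summable_norm_closedLoop_pow hK) (stageMatrix_posSemidef hQ hR K)

/-- The term `t = 0` of the sum is `X` itself, and the rest is positive semidefinite. -/
theorem stateMoment_posDef {S : LQData n m d} {K : Controller n m d} (hK : K ∈ S.stabilizing)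
    {X : Matrix (Fin n ⊕ Fin n) (Fin n ⊕ Fin n) ℝ} (hX : X.PosDef) :
    (S.stateMoment K X).PosDef := by
  have h1 := lyapunovSum_posSemidef (summable_norm_closedLoop_pow hK).transpose_norm_pow
    hX.posSemidef
  have h2 := h1.mul_mul_conjTranspose_same (S.closedLoop K)
  rw [stateMoment_eq hK]
  exact hX.add_posSemidef (by simpa [stateMoment] using h2)

theorem tsum_stageCost {S : LQData n m d} {K : Controller n m d} (hK : K ∈ S.stabilizing)
    (z : (Fin n → ℝ) × (Fin n → ℝ)) : ∑' t : ℕ, S.stageCost K (S.traj K z t) =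
      Sum.elim z.1 z.2 ⬝ᵥ S.costMatrix K *ᵥ Sum.elim z.1 z.2 := by
  set x := Sum.elim z.1 z.2 with hx
  have hc : Continuous fun N : Matrix (Fin n ⊕ Fin n) (Fin n ⊕ Fin n) ℝ => x ⬝ᵥ N *ᵥ x :=
    continuous_const.dotProduct (continuous_id.matrix_mulVec continuous_const)
  have hs := ((summable_lyapunov (summable_norm_closedLoop_pow hK) (S.stageMatrix K)).hasSum.map
      (AddMonoidHom.mk' (fun N : Matrix (Fin n ⊕ Fin n) (Fin n ⊕ Fin n) ℝ => x ⬝ᵥ N *ᵥ x)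
        fun a b => by simp [Matrix.add_mulVec]) hc)
  refine Eq.trans (tsum_congr fun t => ?_) hs.tsum_eq
  rw [stageCost_eq, sumElim_traj, ← hx]
  simp only [Function.comp_apply, AddMonoidHom.mk'_apply]
  rw [Matrix.mul_assoc, ← Matrix.mulVec_mulVec, ← Matrix.mulVec_mulVec,
    Matrix.dotProduct_mulVec x, ← Matrix.transpose_pow, Matrix.vecMul_transpose]

theorem integrable_mul_coord {μ : Measure ((Fin n → ℝ) × (Fin n → ℝ))}
    (hμ : MemLp (fun z : (Fin n → ℝ) × (Fin n → ℝ) => z) 2 μ) (i j : Fin n ⊕ Fin n) :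
    Integrable (fun z : (Fin n → ℝ) × (Fin n → ℝ) =>
      Sum.elim z.1 z.2 i * Sum.elim z.1 z.2 j) μ := by
  have h : ∀ i : Fin n ⊕ Fin n,
      MemLp (fun z : (Fin n → ℝ) × (Fin n → ℝ) => Sum.elim z.1 z.2 i) 2 μ := by
    intro i
    refine hμ.of_le ?_ (Eventually.of_forall fun z => ?_)
    · refine Continuous.aestronglyMeasurable ?_
      rcases i with i | i <;> simp only [Sum.elim_inl, Sum.elim_inr] <;> fun_prop
    · rcases i with i | i
      · exact (norm_le_pi_norm z.1 i).trans (norm_fst_le z)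
      · exact (norm_le_pi_norm z.2 i).trans (norm_snd_le z)
  exact (h i).integrable_mul (h j)

theorem secondMoment_transpose (μ : Measure ((Fin n → ℝ) × (Fin n → ℝ))) :
    (secondMoment μ)ᵀ = secondMoment μ := by
  ext i j
  simp [secondMoment, mul_comm]

theorem cost_eq_trace {S : LQData n m d} {μ : Measure ((Fin n → ℝ) × (Fin n → ℝ))}
    (hμ : MemLp (fun z : (Fin n → ℝ) × (Fin n → ℝ) => z) 2 μ) {K : Controller n m d}
    (hK : K ∈ S.stabilizing) :
    S.cost μ K = (S.costMatrix K * secondMoment μ).trace := by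
  have h : ∀ i j : Fin n ⊕ Fin n, Integrable (fun z : (Fin n → ℝ) × (Fin n → ℝ) =>
      Sum.elim z.1 z.2 i * (S.costMatrix K i j * Sum.elim z.1 z.2 j)) μ := fun i j =>
    ((integrable_mul_coord hμ i j).const_mul (S.costMatrix K i j)).congr
      (Eventually.of_forall fun z => by ring)
  simp only [cost, tsum_stageCost hK, dotProduct, Matrix.mulVec, Finset.mul_sum, Matrix.trace,
    Matrix.diag, Matrix.mul_apply]
  rw [integral_finsetSum _ fun i _ => integrable_finsetSum _ fun j _ => h i j]
  refine Finset.sum_congr rfl fun i _ => ?_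
  rw [integral_finsetSum _ fun j _ => h i j]
  refine Finset.sum_congr rfl fun j _ => ?_
  rw [secondMoment, Matrix.of_apply, ← integral_const_mul]
  congr 1
  ext z
  ring

/-- The linear part of the affine map `closedLoop`. -/
def closedLoopDir (S : LQData n m d) (E : Controller n m d) :
    Matrix (Fin n ⊕ Fin n) (Fin n ⊕ Fin n) ℝ :=
  Matrix.fromBlocks 0 (S.B * E.CK) (E.BK * S.C) E.AK

theorem closedLoop_add_smul (S : LQData n m d) (K E : Controller n m d) (s : ℝ) :
    S.closedLoop (K + s • E) = S.closedLoop K + s • S.closedLoopDir E := by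
  simp only [closedLoop, closedLoopDir, Matrix.fromBlocks_add, Matrix.fromBlocks_smul,
    Controller.AK, Controller.BK, Controller.CK, Prod.fst_add, Prod.snd_add, Prod.smul_fst,
    Prod.smul_snd, Matrix.mul_add, Matrix.add_mul, Matrix.mul_smul, Matrix.smul_mul, smul_zero,
    add_zero]

theorem stageMatrix_add_smul (S : LQData n m d) (K E : Controller n m d) (s : ℝ) :
    S.stageMatrix (K + s • E) = S.stageMatrix K +
      s • (Matrix.fromBlocks 0 0 0 (E.CKᵀ * S.R * K.CK + K.CKᵀ * S.R * E.CK) +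
        s • Matrix.fromBlocks 0 0 0 (E.CKᵀ * S.R * E.CK)) := by
  simp only [stageMatrix, Controller.CK, Matrix.fromBlocks_add, Matrix.fromBlocks_smul,
    smul_zero, add_zero,
    Prod.snd_add, Prod.smul_snd, Matrix.mul_add, Matrix.add_mul, Matrix.transpose_add,
    Matrix.transpose_smul, Matrix.smul_mul, Matrix.mul_smul, smul_add]
  congr 1
  abel

theorem eventually_stabilizing {S : LQData n m d} {K : Controller n m d}
    (hK : K ∈ S.stabilizing) (E : Controller n m d) :
    ∀ᶠ s : ℝ in 𝓝 0, K + s • E ∈ S.stabilizing := by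
  have hc : Tendsto (fun s : ℝ => S.closedLoop (K + s • E)) (𝓝 0) (𝓝 (S.closedLoop K)) := by
    simp only [closedLoop_add_smul]
    have : Continuous fun s : ℝ => S.closedLoop K + s • S.closedLoopDir E := by fun_prop
    simpa using this.tendsto 0
  exact hc.eventually (Matrix.eventually_spectralRadius_lt_one hK)

theorem tendsto_costMatrix {S : LQData n m d} {K : Controller n m d}
    (hK : K ∈ S.stabilizing) (E : Controller n m d) :
    Tendsto (fun s : ℝ => S.costMatrix (K + s • E)) (𝓝 0) (𝓝 (S.costMatrix K)) := by
  refine tendsto_lyapunovSum ?_ ?_ (summable_norm_closedLoop_pow hK)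
    ((eventually_stabilizing hK E).mono fun s hs => summable_norm_closedLoop_pow hs)
  · simp only [closedLoop_add_smul]
    have : Continuous fun s : ℝ => S.closedLoop K + s • S.closedLoopDir E := by fun_prop
    simpa using this.tendsto 0
  · simp only [stageMatrix_add_smul]
    generalize Matrix.fromBlocks 0 0 0 (E.CKᵀ * S.R * K.CK + K.CKᵀ * S.R * E.CK) = V
    generalize Matrix.fromBlocks 0 0 0 (E.CKᵀ * S.R * E.CK) = V'
    have : Continuous fun s : ℝ => S.stageMatrix K + s • (V + s • V') := by fun_prop
    simpa using this.tendsto 0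

/-- Substitute `X = Y - M * Y * Mᵀ`, with `Y` the moment of `K`, and move `M` across the trace.
Costs of different `K'` become traces against the same `Y`, so they can be subtracted directly. -/
theorem trace_costMatrix_mul {S : LQData n m d} {K K' : Controller n m d} (hK : K ∈ S.stabilizing)
    (hK' : K' ∈ S.stabilizing) (X : Matrix (Fin n ⊕ Fin n) (Fin n ⊕ Fin n) ℝ) :
    (S.costMatrix K' * X).trace =
      ((S.stageMatrix K' + (S.closedLoop K')ᵀ * S.costMatrix K' * S.closedLoop K' -
        (S.closedLoop K)ᵀ * S.costMatrix K' * S.closedLoop K) * S.stateMoment K X).trace := by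
  rw [← costMatrix_eq hK', Matrix.sub_mul, Matrix.trace_sub, Matrix.mul_assoc (_ * _),
    Matrix.mul_assoc, Matrix.trace_mul_comm (S.closedLoop K)ᵀ, Matrix.mul_assoc,
    ← Matrix.trace_sub, ← Matrix.mul_sub]
  congr 2
  rw [eq_sub_iff_add_eq]
  exact (stateMoment_eq hK X).symm

/-- By `trace_costMatrix_mul`, the difference quotient is an explicit expression in `s` and the cost
matrix at `K + s • E`. Continuity of the cost matrix along the line therefore suffices; it is never
differentiated. -/
theorem hasDerivAt_cost {S : LQData n m d}
    {μ : Measure ((Fin n → ℝ) × (Fin n → ℝ))}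
    (hμ : MemLp (fun z : (Fin n → ℝ) × (Fin n → ℝ) => z) 2 μ) {K : Controller n m d}
    (hK : K ∈ S.stabilizing) (E : Controller n m d) :
    HasDerivAt (fun s : ℝ => S.cost μ (K + s • E))
      (((Matrix.fromBlocks 0 0 0 (E.CKᵀ * S.R * K.CK + K.CKᵀ * S.R * E.CK) +
        ((S.closedLoopDir E)ᵀ * S.costMatrix K * S.closedLoop K +
        (S.closedLoop K)ᵀ * S.costMatrix K * S.closedLoopDir E)) *
          S.stateMoment K (secondMoment μ)).trace) 0 := by
  set X := secondMoment μ
  set V := Matrix.fromBlocks 0 0 0 (E.CKᵀ * S.R * K.CK + K.CKᵀ * S.R * E.CK) with hV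
  set V' : Matrix (Fin n ⊕ Fin n) (Fin n ⊕ Fin n) ℝ :=
    Matrix.fromBlocks 0 0 0 (E.CKᵀ * S.R * E.CK) with hV'
  set D := S.closedLoopDir E with hD
  set M := S.closedLoop K with hM
  set Y := S.stateMoment K X with hY
  have hP := tendsto_costMatrix hK E
  have hlim : Tendsto (fun s : ℝ => ((V + s • V' + (Dᵀ * S.costMatrix (K + s • E) * M +
      Mᵀ * S.costMatrix (K + s • E) * D + s • (Dᵀ * S.costMatrix (K + s • E) * D))) * Y).trace)
      (𝓝 0) (𝓝 ((V + (Dᵀ * S.costMatrix K * M + Mᵀ * S.costMatrix K * D)) * Y).trace) := by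
    have hc : Continuous fun p : ℝ × Matrix (Fin n ⊕ Fin n) (Fin n ⊕ Fin n) ℝ =>
        ((V + p.1 • V' + (Dᵀ * p.2 * M + Mᵀ * p.2 * D + p.1 • (Dᵀ * p.2 * D))) * Y).trace := by
      refine Continuous.matrix_trace ?_
      fun_prop
    have := (hc.tendsto (0, S.costMatrix K)).comp (tendsto_id.prodMk_nhds hP)
    simpa [Function.comp_def] using this
  rw [hasDerivAt_iff_tendsto_slope_zero]
  refine (hlim.mono_left nhdsWithin_le_nhds).congr' ?_
  filter_upwards [self_mem_nhdsWithin, nhdsWithin_le_nhds (eventually_stabilizing hK E)]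
    with s hs0 hs
  have hs0' : s ≠ 0 := hs0
  simp only [zero_add, zero_smul, add_zero]
  rw [cost_eq_trace hμ hs, cost_eq_trace hμ hK, trace_costMatrix_mul hK hs,
    trace_costMatrix_mul hK hK, ← Matrix.trace_sub, ← Matrix.trace_smul, ← Matrix.sub_mul,
    closedLoop_add_smul, stageMatrix_add_smul, ← hV, ← hV', ← hD, ← hM, ← hY]
  congr 1
  rw [eq_inv_smul_iff₀ hs0']
  simp only [Matrix.transpose_add, Matrix.transpose_smul, Matrix.add_mul, Matrix.sub_mul,
    Matrix.mul_add, Matrix.smul_mul, Matrix.mul_smul, smul_add]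
  abel

end LQData

/-! ### Linear algebra of semidefinite, observable and block matrices. -/

theorem Matrix.PosSemidef.mulVec_eq_zero_of_dotProduct {ι : Type*} [Fintype ι]
    {P : Matrix ι ι ℝ} (hP : P.PosSemidef) {v : ι → ℝ} (h : v ⬝ᵥ P *ᵥ v = 0) : P *ᵥ v = 0 := by
  have := (hP.dotProduct_mulVec_zero_iff v).1 (by simpa using h)
  exact this

theorem IsObservablePair.eq_zero {n p : ℕ} {C : Matrix (Fin p) (Fin n) ℝ}
    {A : Matrix (Fin n) (Fin n) ℝ} (h : IsObservablePair C A) {v : Fin n → ℝ}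
    (hv : ∀ t : ℕ, C *ᵥ (A ^ t *ᵥ v) = 0) : v = 0 := by
  set O := Matrix.of fun (r : Fin n × Fin p) (j : Fin n) => (C * A ^ (r.1 : ℕ)) r.2 j with hO
  have hr : O.rank = n := h
  have hli : LinearIndependent ℝ O.col := by
    rw [linearIndependent_iff_card_eq_finrank_span, Set.finrank,
      ← Matrix.rank_eq_finrank_span_cols, hr,
      Fintype.card_fin]
  refine Matrix.mulVec_injective_iff.2 hli (?_ : O *ᵥ v = O *ᵥ 0)
  rw [Matrix.mulVec_zero]
  ext r
  have := congrFun (hv r.1) r.2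
  rw [Matrix.mulVec_mulVec] at this
  exact this

theorem Matrix.mul_transpose_posDef_of_rank_eq {n d : ℕ} {C : Matrix (Fin d) (Fin n) ℝ}
    (hC : C.rank = d) {Y : Matrix (Fin n) (Fin n) ℝ} (hY : Y.PosDef) : (C * Y * Cᵀ).PosDef := by
  have hli : LinearIndependent ℝ C.row := by
    rw [linearIndependent_iff_card_eq_finrank_span, Set.finrank,
      ← Matrix.rank_eq_finrank_span_row, hC,
      Fintype.card_fin]
  simpa using hY.mul_mul_conjTranspose_same (B := C) (Matrix.vecMul_injective_iff.2 hli)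

theorem Matrix.trace_fromBlocks_eq_add {l n : Type*} [Fintype l] [Fintype n] (A : Matrix l l ℝ)
    (B : Matrix l n ℝ) (C : Matrix n l ℝ) (D : Matrix n n ℝ) :
    (Matrix.fromBlocks A B C D).trace = A.trace + D.trace := by
  simp [Matrix.trace, Fintype.sum_sum_type]

/-! ### Stationarity in block form, and definiteness from observability. -/

namespace LQData

variable {n m d : ℕ}

/-- Symmetry of `R`, of the cost matrix and of `Y` makes the two terms of each adjoint pair have
equal trace, whence the factor 2. The coefficients of the entries of `E` are then the gradient. -/
theorem hasDerivAt_cost_blocks {S : LQData n m d} (hQ : S.Qᵀ = S.Q) (hR : S.Rᵀ = S.R)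
    {μ : Measure ((Fin n → ℝ) × (Fin n → ℝ))}
    (hμ : MemLp (fun z : (Fin n → ℝ) × (Fin n → ℝ) => z) 2 μ) {K : Controller n m d}
    (hK : K ∈ S.stabilizing) {N Y : Matrix (Fin n ⊕ Fin n) (Fin n ⊕ Fin n) ℝ}
    (hY : Y = S.stateMoment K (secondMoment μ)) (hN : N = S.costMatrix K * S.closedLoop K * Y)
    (E : Controller n m d) :
    HasDerivAt (fun s : ℝ => S.cost μ (K + s • E))
      (2 * ((E.AKᵀ * N.toBlocks₂₂).trace + (E.BKᵀ * (N.toBlocks₂₁ * S.Cᵀ)).trace +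
        (E.CKᵀ * (S.R * K.CK * Y.toBlocks₂₂ + S.Bᵀ * N.toBlocks₁₂)).trace)) 0 := by
  have hPt : (S.costMatrix K)ᵀ = S.costMatrix K := by
    refine lyapunovSum_transpose (summable_norm_closedLoop_pow hK) ?_
    simp [stageMatrix, Matrix.fromBlocks_transpose, hQ, hR, Matrix.mul_assoc]
  have hYt : Yᵀ = Y := by
    rw [hY]
    exact lyapunovSum_transpose (summable_norm_closedLoop_pow hK).transpose_norm_pow
      (secondMoment_transpose μ)
  have hY22 : Y.toBlocks₂₂ᵀ = Y.toBlocks₂₂ := by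
    ext i j
    exact congrFun (congrFun hYt (Sum.inr i)) (Sum.inr j)
  convert hasDerivAt_cost hμ hK E using 1
  rw [← hY]
  have h1 : ((S.closedLoop K)ᵀ * S.costMatrix K * S.closedLoopDir E * Y).trace =
      ((S.closedLoopDir E)ᵀ * N).trace := by
    rw [← Matrix.trace_transpose]
    simp only [Matrix.transpose_mul, hYt, hPt, Matrix.transpose_transpose, hN]
    rw [Matrix.trace_mul_comm]
    simp only [Matrix.mul_assoc]
  have h2 : (Matrix.fromBlocks 0 0 0 (E.CKᵀ * S.R * K.CK + K.CKᵀ * S.R * E.CK) * Y).trace =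
      2 * (E.CKᵀ * (S.R * K.CK * Y.toBlocks₂₂)).trace := by
    have h3 : (K.CKᵀ * S.R * E.CK * Y.toBlocks₂₂).trace =
        (E.CKᵀ * (S.R * K.CK * Y.toBlocks₂₂)).trace := by
      rw [← Matrix.trace_transpose]
      simp only [Matrix.transpose_mul, hY22, hR, Matrix.transpose_transpose]
      rw [Matrix.trace_mul_comm]
      simp only [Matrix.mul_assoc]
    conv_lhs => rw [← Matrix.fromBlocks_toBlocks Y]
    rw [Matrix.fromBlocks_multiply, Matrix.trace_fromBlocks_eq_add]
    simp only [Matrix.zero_mul, zero_add, Matrix.trace_zero, Matrix.add_mul, Matrix.trace_add, h3]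
    simp only [Matrix.mul_assoc]
    ring
  have h4 : ((S.closedLoopDir E)ᵀ * N).trace = (E.AKᵀ * N.toBlocks₂₂).trace +
      (E.BKᵀ * (N.toBlocks₂₁ * S.Cᵀ)).trace + (E.CKᵀ * (S.Bᵀ * N.toBlocks₁₂)).trace := by
    conv_lhs => rw [← Matrix.fromBlocks_toBlocks N]
    rw [closedLoopDir, Matrix.fromBlocks_transpose, Matrix.fromBlocks_multiply,
      Matrix.trace_fromBlocks_eq_add]
    simp only [Matrix.transpose_zero, Matrix.zero_mul, zero_add, Matrix.transpose_mul,
      Matrix.trace_add, Matrix.mul_assoc]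
    rw [Matrix.trace_mul_comm S.Cᵀ, Matrix.mul_assoc]
    ring
  simp only [Matrix.add_mul, Matrix.mul_add, Matrix.trace_add, h1, h2]
  rw [show (S.closedLoopDir E)ᵀ * S.costMatrix K * S.closedLoop K * Y = (S.closedLoopDir E)ᵀ * N by
    rw [hN]; simp only [Matrix.mul_assoc], h4]
  ring

theorem blocks_eq_zero_of_gradCost_eq_zero {S : LQData n m d} (hQ : S.Qᵀ = S.Q) (hR : S.Rᵀ = S.R)
    {μ : Measure ((Fin n → ℝ) × (Fin n → ℝ))}
    (hμ : MemLp (fun z : (Fin n → ℝ) × (Fin n → ℝ) => z) 2 μ) {K : Controller n m d}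
    (hK : K ∈ S.stabilizing) (hg : S.gradCost μ K = 0)
    {N Y : Matrix (Fin n ⊕ Fin n) (Fin n ⊕ Fin n) ℝ}
    (hY : Y = S.stateMoment K (secondMoment μ)) (hN : N = S.costMatrix K * S.closedLoop K * Y) :
    N.toBlocks₂₂ = 0 ∧ N.toBlocks₂₁ * S.Cᵀ = 0 ∧
      S.R * K.CK * Y.toBlocks₂₂ + S.Bᵀ * N.toBlocks₁₂ = 0 := by
  have hd := hasDerivAt_cost_blocks hQ hR hμ hK hY hN
  simp only [gradCost, Prod.mk_eq_zero] at hg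
  obtain ⟨h1, h2, h3⟩ := hg
  refine ⟨?_, ?_, ?_⟩ <;> ext i j
  · have := congrFun (congrFun h1 i) j
    rw [Matrix.of_apply, (hd _).deriv] at this
    simpa [Controller.AK, Controller.BK, Controller.CK, Matrix.trace_single_mul] using this
  · have := congrFun (congrFun h2 i) j
    rw [Matrix.of_apply, (hd _).deriv] at this
    simpa [Controller.AK, Controller.BK, Controller.CK, Matrix.trace_single_mul] using this
  · have := congrFun (congrFun h3 i) j
    rw [Matrix.of_apply, (hd _).deriv] at this
    simpa [Controller.AK, Controller.BK, Controller.CK, Matrix.trace_single_mul] using this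

/-- Stability persists along short segments through `K`, so the cost has a local minimum at 0 along
every line. -/
theorem IsGloballyOptimal.gradCost_eq_zero {S : LQData n m d}
    {μ : Measure ((Fin n → ℝ) × (Fin n → ℝ))} {K : Controller n m d}
    (hK : S.IsGloballyOptimal μ K) : S.gradCost μ K = 0 := by
  have h : ∀ E : Controller n m d, deriv (fun s : ℝ => S.cost μ (K + s • E)) 0 = 0 := by
    intro E
    refine IsLocalMin.deriv_eq_zero ?_
    filter_upwards [eventually_stabilizing hK.1 E] with s hs
    simpa using hK.2 _ hs
  simp only [gradCost, h]
  rfl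

/-- If starting from `(0, ξ)` costs nothing, then neither does the first stage nor the remainder. As
`R > 0`, the first gives `C_K ξ = 0`; the plant then stays at rest and the next state is `(0, A_K
ξ)`, again of zero cost. So `C_K` vanishes along the whole orbit of `ξ` under `A_K`, and
observability gives `ξ = 0`. -/
theorem costMatrix_toBlocks₂₂_posDef {S : LQData n m d} (hQ : S.Q.PosSemidef) (hR : S.R.PosDef)
    {K : Controller n m d} (hK : K ∈ S.stabilizing) (ho : K ∈ observableControllers n m d) :
    (S.costMatrix K).toBlocks₂₂.PosDef := by
  have hP := costMatrix_posSemidef hQ hR hK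
  set P := S.costMatrix K with hPdef
  have hker : ∀ ξ : Fin n → ℝ, P *ᵥ Sum.elim 0 ξ = 0 →
      K.CK *ᵥ ξ = 0 ∧ P *ᵥ Sum.elim 0 (K.AK *ᵥ ξ) = 0 := by
    intro ξ hξ
    set v : Fin n ⊕ Fin n → ℝ := Sum.elim 0 ξ with hv
    have h0 : v ⬝ᵥ P *ᵥ v = 0 := by rw [hξ, dotProduct_zero]
    have h1 : v ⬝ᵥ P *ᵥ v = v ⬝ᵥ S.stageMatrix K *ᵥ v +
        (S.closedLoop K *ᵥ v) ⬝ᵥ P *ᵥ (S.closedLoop K *ᵥ v) := by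
      conv_lhs => rw [hPdef, costMatrix_eq hK, ← hPdef]
      rw [Matrix.add_mulVec, dotProduct_add, Matrix.mul_assoc, ← Matrix.mulVec_mulVec,
        ← Matrix.mulVec_mulVec, Matrix.dotProduct_mulVec v (S.closedLoop K)ᵀ,
        Matrix.vecMul_transpose]
    have h2 := (stageMatrix_posSemidef hQ hR K).dotProduct_mulVec_nonneg v
    have h3 := hP.dotProduct_mulVec_nonneg (S.closedLoop K *ᵥ v)
    simp only [star_trivial] at h2 h3
    have h4 : v ⬝ᵥ S.stageMatrix K *ᵥ v = 0 := by linarith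
    have h5 : (S.closedLoop K *ᵥ v) ⬝ᵥ P *ᵥ (S.closedLoop K *ᵥ v) = 0 := by linarith
    have h6 : K.CK *ᵥ ξ = 0 := by
      have h7 := stageCost_eq S K (0, ξ)
      rw [h4] at h7
      simp only [stageCost, zero_dotProduct, zero_add] at h7
      by_contra hne
      have := hR.dotProduct_mulVec_pos hne
      rw [star_trivial] at this
      linarith
    refine ⟨h6, ?_⟩
    have h8 := hP.mulVec_eq_zero_of_dotProduct h5
    rw [closedLoop, hv, Matrix.fromBlocks_mulVec] at h8
    simpa [← Matrix.mulVec_mulVec, h6] using h8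
  refine Matrix.PosDef.of_dotProduct_mulVec_pos ?_ fun ξ hξ => ?_
  · exact hP.isHermitian.submatrix Sum.inr
  · have he : star ξ ⬝ᵥ P.toBlocks₂₂ *ᵥ ξ = Sum.elim 0 ξ ⬝ᵥ P *ᵥ Sum.elim 0 ξ := by
      conv_rhs => rw [← Matrix.fromBlocks_toBlocks P]
      rw [Matrix.fromBlocks_mulVec, sumElim_dotProduct_sumElim]
      simp
    rw [he]
    have h0 := hP.dotProduct_mulVec_nonneg (Sum.elim 0 ξ)
    rw [star_trivial] at h0
    refine lt_of_le_of_ne h0 fun h => hξ ?_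
    have h1 : ∀ t : ℕ, P *ᵥ Sum.elim 0 (K.AK ^ t *ᵥ ξ) = 0 := by
      intro t
      induction t with
      | zero => simpa using hP.mulVec_eq_zero_of_dotProduct h.symm
      | succ t ih =>
        rw [pow_succ', ← Matrix.mulVec_mulVec]
        exact (hker _ ih).2
    exact IsObservablePair.eq_zero ho fun t => (hker _ (h1 t)).1

end LQData

/-! ### Observer form of stationary controllers. -/

namespace LQData

variable {n m d : ℕ}

/-- The block form, adapted to the coordinates `(x, ξ - T x)`, of a cost matrix. -/
theorem lyapunov_blocks {S : LQData n m d} {K : Controller n m d}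
    {Pi P T : Matrix (Fin n) (Fin n) ℝ}
    (h : Matrix.fromBlocks (Pi + Tᵀ * P * T) (-(Tᵀ * P)) (-(P * T)) P = S.stageMatrix K +
      (S.closedLoop K)ᵀ * Matrix.fromBlocks (Pi + Tᵀ * P * T) (-(Tᵀ * P)) (-(P * T)) P *
        S.closedLoop K) :
    Pi + Tᵀ * P * T = S.Q + S.Aᵀ * Pi * S.A +
        (K.BK * S.C - T * S.A)ᵀ * P * (K.BK * S.C - T * S.A) ∧
      -(P * T) = K.CKᵀ * S.Bᵀ * Pi * S.A +
        (K.AK - T * S.B * K.CK)ᵀ * P * (K.BK * S.C - T * S.A) ∧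
      P = K.CKᵀ * (S.R + S.Bᵀ * Pi * S.B) * K.CK +
        (K.AK - T * S.B * K.CK)ᵀ * P * (K.AK - T * S.B * K.CK) := by
  rw [stageMatrix, closedLoop, Matrix.fromBlocks_transpose, Matrix.fromBlocks_multiply,
    Matrix.fromBlocks_multiply, Matrix.fromBlocks_add, Matrix.fromBlocks_inj] at h
  obtain ⟨h11, -, h21, h22⟩ := h
  refine ⟨h11.trans ?_, h21.trans ?_, h22.trans ?_⟩ <;>
  · simp only [Matrix.transpose_sub, Matrix.transpose_mul, Matrix.mul_add, Matrix.add_mul,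
      Matrix.mul_sub, Matrix.sub_mul, Matrix.mul_neg, Matrix.neg_mul, Matrix.mul_assoc]
    abel

/-- The upper right block is written through the lower right one because stationarity in `A_K` makes
the latter vanish. -/
theorem gradient_blocks {S : LQData n m d} {K : Controller n m d}
    {Pi P T Y₁₁ Y₁₂ Y₂₁ Y₂₂ : Matrix (Fin n) (Fin n) ℝ}
    {N : Matrix (Fin n ⊕ Fin n) (Fin n ⊕ Fin n) ℝ}
    (hN : N = Matrix.fromBlocks (Pi + Tᵀ * P * T) (-(Tᵀ * P)) (-(P * T)) P * S.closedLoop K *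
      Matrix.fromBlocks Y₁₁ Y₁₂ Y₂₁ Y₂₂) :
    N.toBlocks₁₂ = Pi * (S.A * Y₁₂ + S.B * K.CK * Y₂₂) - Tᵀ * N.toBlocks₂₂ ∧
      N.toBlocks₂₁ = P * ((K.BK * S.C - T * S.A) * Y₁₁ + (K.AK - T * S.B * K.CK) * Y₂₁) ∧
      N.toBlocks₂₂ = P * ((K.BK * S.C - T * S.A) * Y₁₂ + (K.AK - T * S.B * K.CK) * Y₂₂) := by
  rw [closedLoop, Matrix.fromBlocks_multiply, Matrix.fromBlocks_multiply] at hN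
  rw [hN, Matrix.toBlocks_fromBlocks₁₂, Matrix.toBlocks_fromBlocks₂₁,
    Matrix.toBlocks_fromBlocks₂₂]
  refine ⟨?_, ?_, ?_⟩ <;>
  · simp only [Matrix.mul_add, Matrix.add_mul, Matrix.mul_sub, Matrix.sub_mul, Matrix.mul_neg,
      Matrix.neg_mul, Matrix.mul_assoc]
    abel

/-- `K` is, up to the change of coordinates `G = T⁻¹` of its state, the observer-based controller
with feedback gain `F` and observer gain `L` obtained from the solutions `Pi` and `Y` of the control
and filter Riccati equations. -/
structure IsObserverBased (S : LQData n m d) (X₁₁ X₁₂ X₂₁ X₂₂ : Matrix (Fin n) (Fin n) ℝ)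
    (K : Controller n m d) (G T Pi Y : Matrix (Fin n) (Fin n) ℝ) (F : Matrix (Fin m) (Fin n) ℝ)
    (L : Matrix (Fin n) (Fin d) ℝ) : Prop where
  TG : T * G = 1
  AK_eq : K.AK = T * (S.A - S.B * F - L * S.C) * G
  BK_eq : K.BK = T * L
  CK_eq : K.CK = -(F * G)
  G_mul : G * X₂₂ = X₁₂
  Pi_symm : Piᵀ = Pi
  Pi_eq : Pi = S.Q + S.Aᵀ * Pi * (S.A - S.B * F)
  F_eq : (S.R + S.Bᵀ * Pi * S.B) * F = S.Bᵀ * Pi * S.A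
  isUnit_control : IsUnit (S.R + S.Bᵀ * Pi * S.B)
  control_stable : Tendsto (fun t : ℕ => (S.A - S.B * F) ^ t) atTop (𝓝 0)
  Y_symm : Yᵀ = Y
  Y_eq : Y = (S.A - L * S.C) * Y * S.Aᵀ + (X₁₁ - G * X₂₁)
  L_eq : L * (S.C * Y * S.Cᵀ) = S.A * Y * S.Cᵀ
  isUnit_filter : IsUnit (S.C * Y * S.Cᵀ)
  filter_stable : Tendsto (fun t : ℕ => (S.A - L * S.C) ^ t) atTop (𝓝 0)

theorem _root_.Matrix.tendsto_transpose_pow {l : Type*} [Fintype l] [DecidableEq l]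
    {E : Matrix l l ℝ} (h : Tendsto (fun t : ℕ => E ^ t) atTop (𝓝 0)) :
    Tendsto (fun t : ℕ => Eᵀ ^ t) atTop (𝓝 0) := by
  have hc : Continuous fun N : Matrix l l ℝ => Nᵀ := continuous_id.matrix_transpose
  have := (hc.tendsto 0).comp h
  simpa [Function.comp_def, Matrix.transpose_pow] using this

/-! ### Uniqueness of the Riccati solutions and of the observer form. -/

section Uniqueness

variable {S : LQData n m d} {X₁₁ X₁₂ X₂₁ X₂₂ : Matrix (Fin n) (Fin n) ℝ}
  {K K' : Controller n m d} {G T Pi Y G' T' Pi' Y' : Matrix (Fin n) (Fin n) ℝ}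
  {F F' : Matrix (Fin m) (Fin n) ℝ} {L L' : Matrix (Fin n) (Fin d) ℝ}

theorem IsObserverBased.transpose_mul_Pi_mul_B (hRt : S.Rᵀ = S.R)
    (h : S.IsObserverBased X₁₁ X₁₂ X₂₁ X₂₂ K G T Pi Y F L) :
    (S.A - S.B * F)ᵀ * Pi * S.B = Fᵀ * S.R := by
  have h2 := congrArg Matrix.transpose h.F_eq
  simp only [Matrix.transpose_add, Matrix.transpose_mul, Matrix.transpose_transpose, h.Pi_symm,
    hRt, Matrix.mul_add, Matrix.mul_assoc] at h2
  simp only [Matrix.transpose_sub, Matrix.transpose_mul, Matrix.sub_mul, Matrix.mul_assoc]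
  rw [← h2]
  abel

/-- Both solutions satisfy one linear equation that mixes the two gains: `F` on the left, `F'` on
the right. Their difference `D` thus obeys `D = (A - B F)ᵀ D (A - B F')`, and stability of both
factors kills it. -/
theorem IsObserverBased.Pi_unique (hQt : S.Qᵀ = S.Q) (hRt : S.Rᵀ = S.R)
    (h : S.IsObserverBased X₁₁ X₁₂ X₂₁ X₂₂ K G T Pi Y F L)
    (h' : S.IsObserverBased X₁₁ X₁₂ X₂₁ X₂₂ K' G' T' Pi' Y' F' L') : Pi = Pi' := by
  have e1 : Pi = S.Q + ((S.A - S.B * F)ᵀ * Pi * (S.A - S.B * F') + Fᵀ * S.R * F') := by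
    have h2 := congrArg Matrix.transpose h.Pi_eq
    simp only [Matrix.transpose_add, Matrix.transpose_mul, Matrix.transpose_transpose, h.Pi_symm,
      hQt] at h2
    refine h2.trans ?_
    rw [← h.transpose_mul_Pi_mul_B hRt]
    simp only [Matrix.mul_sub, Matrix.mul_assoc]
    abel
  have e2 : Pi' = S.Q + ((S.A - S.B * F)ᵀ * Pi' * (S.A - S.B * F') + Fᵀ * S.R * F') := by
    refine h'.Pi_eq.trans ?_
    have h2 := congrArg Matrix.transpose (h'.transpose_mul_Pi_mul_B hRt)
    simp only [Matrix.transpose_mul, Matrix.transpose_transpose, h'.Pi_symm, hRt] at h2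
    rw [Matrix.mul_assoc Fᵀ, ← h2]
    simp only [Matrix.transpose_sub, Matrix.transpose_mul, Matrix.sub_mul, Matrix.mul_assoc]
    abel
  rw [← sub_eq_zero]
  refine Matrix.eq_zero_of_eq_mul_mul (Matrix.tendsto_transpose_pow h.control_stable)
    h'.control_stable ?_
  refine (congrArg₂ (· - ·) e1 e2).trans ?_
  rw [Matrix.mul_sub _ Pi Pi', Matrix.sub_mul (_ * Pi)]
  abel

/-- The gain equation says `(A - L C) Y Cᵀ = 0`, so an arbitrary gain `Z` can be inserted on the
right; taking the gain of the other controller gives the mixed equation for `Y_unique`. -/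
theorem IsObserverBased.filter_mul_transpose (h : S.IsObserverBased X₁₁ X₁₂ X₂₁ X₂₂ K G T Pi Y F L)
    {Z : Matrix (Fin n) (Fin d) ℝ} :
    (S.A - L * S.C) * Y * S.Aᵀ = (S.A - L * S.C) * Y * (S.A - Z * S.C)ᵀ := by
  have h1 : (S.A - L * S.C) * Y * S.Cᵀ = 0 := by
    simp only [Matrix.sub_mul, sub_eq_zero]
    rw [← h.L_eq]
    simp only [Matrix.mul_assoc]
  rw [Matrix.transpose_sub, Matrix.mul_sub, Matrix.transpose_mul, ← Matrix.mul_assoc _ S.Cᵀ, h1,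
    Matrix.zero_mul, sub_zero]

theorem IsObserverBased.Y_unique (h : S.IsObserverBased X₁₁ X₁₂ X₂₁ X₂₂ K G T Pi Y F L)
    (h' : S.IsObserverBased X₁₁ X₁₂ X₂₁ X₂₂ K' G T' Pi' Y' F' L') (hX : (X₁₁ - G * X₂₁)ᵀ =
      X₁₁ - G * X₂₁) : Y = Y' := by
  have e1 : Y = (S.A - L * S.C) * Y * (S.A - L' * S.C)ᵀ + (X₁₁ - G * X₂₁) := by
    rw [← h.filter_mul_transpose]
    exact h.Y_eq
  have e2 : Y' = (S.A - L * S.C) * Y' * (S.A - L' * S.C)ᵀ + (X₁₁ - G * X₂₁) := by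
    have h2 := h'.Y_eq
    rw [h'.filter_mul_transpose (Z := L)] at h2
    have h3 := congrArg Matrix.transpose h2
    simp only [Matrix.transpose_add, Matrix.transpose_mul, Matrix.transpose_transpose, h'.Y_symm,
      hX] at h3
    rwa [← Matrix.mul_assoc] at h3
  rw [← sub_eq_zero]
  refine Matrix.eq_zero_of_eq_mul_mul h.filter_stable
    (Matrix.tendsto_transpose_pow h'.filter_stable) ?_
  refine (congrArg₂ (· - ·) e1 e2).trans ?_
  rw [Matrix.mul_sub _ Y Y', Matrix.sub_mul (_ * Y)]
  abel

/-- The coordinates must be settled first: `G` is fixed by `X₁₂` and `X₂₂`, and it enters the filter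
equation through the source `X₁₁ - G * X₂₁`, a Schur complement of `X` and hence symmetric. -/
theorem IsObserverBased.unique (hQt : S.Qᵀ = S.Q) (hRt : S.Rᵀ = S.R) (h₁₁ : X₁₁ᵀ = X₁₁)
    (h₁₂ : X₁₂ᵀ = X₂₁) (h₂₂ : X₂₂ᵀ = X₂₂) (hu : IsUnit X₂₂)
    (h : S.IsObserverBased X₁₁ X₁₂ X₂₁ X₂₂ K G T Pi Y F L)
    (h' : S.IsObserverBased X₁₁ X₁₂ X₂₁ X₂₂ K' G' T' Pi' Y' F' L') : K = K' := by
  obtain rfl : G = G' := hu.mul_right_cancel (h.G_mul.trans h'.G_mul.symm)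
  obtain rfl : T = T' := by
    have hGT : G * T' = 1 := mul_eq_one_comm.1 h'.TG
    calc T = T * (G * T') := by rw [hGT, mul_one]
      _ = T' := by rw [← mul_assoc, h.TG, one_mul]
  obtain rfl := h.Pi_unique hQt hRt h'
  have hX : (X₁₁ - G * X₂₁)ᵀ = X₁₁ - G * X₂₁ := by
    have h1 : X₂₁ = X₂₂ * Gᵀ := by rw [← h₁₂, ← h.G_mul, Matrix.transpose_mul, h₂₂]
    rw [h1]
    simp only [Matrix.transpose_sub, Matrix.transpose_mul, Matrix.transpose_transpose, h₁₁, h₂₂,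
      Matrix.mul_assoc]
  obtain rfl := h.Y_unique h' hX
  obtain rfl : F = F' := by
    have hdet := (Matrix.isUnit_iff_isUnit_det _).1 h.isUnit_control
    have := h.F_eq.trans h'.F_eq.symm
    rw [← Matrix.nonsing_inv_mul_cancel_left _ F hdet, this,
      Matrix.nonsing_inv_mul_cancel_left _ F' hdet]
  obtain rfl : L = L' := by
    have hdet := (Matrix.isUnit_iff_isUnit_det _).1 h.isUnit_filter
    have := h.L_eq.trans h'.L_eq.symm
    rw [← Matrix.mul_nonsing_inv_cancel_right _ L hdet, this,
      Matrix.mul_nonsing_inv_cancel_right _ L' hdet]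
  exact Prod.ext (h.AK_eq.trans h'.AK_eq.symm)
    (Prod.ext (h.BK_eq.trans h'.BK_eq.symm) (h.CK_eq.trans h'.CK_eq.symm))

end Uniqueness

/-- `T` and `G` arise independently, from the cost and moment matrices. Stationarity expresses `B_K`
through `T` and `C_K` through `G`; the Lyapunov equation for the cost then shows that the two are
inverse to each other. -/
theorem exists_isObserverBased {S : LQData n m d} (hQ : S.Q.PosSemidef) (hR : S.R.PosDef)
    (hC : S.C.rank = d) {μ : Measure ((Fin n → ℝ) × (Fin n → ℝ))}
    (hμ : MemLp (fun z : (Fin n → ℝ) × (Fin n → ℝ) => z) 2 μ) (hX : (secondMoment μ).PosDef)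
    {K : Controller n m d} (hs : K ∈ S.stationary μ) (ho : K ∈ observableControllers n m d) :
    ∃ G T Pi Y F L, S.IsObserverBased (secondMoment μ).toBlocks₁₁ (secondMoment μ).toBlocks₁₂
      (secondMoment μ).toBlocks₂₁ (secondMoment μ).toBlocks₂₂ K G T Pi Y F L := by
  obtain ⟨hK, hg⟩ := hs
  have hQt : S.Qᵀ = S.Q := by simpa using hQ.isHermitian.eq
  have hRt : S.Rᵀ = S.R := by simpa using hR.isHermitian.eq
  obtain ⟨g22, g21, g12⟩ := blocks_eq_zero_of_gradCost_eq_zero hQt hRt hμ hK hg rfl rfl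
  have hPsd := costMatrix_posSemidef hQ hR hK
  have hP22 := costMatrix_toBlocks₂₂_posDef hQ hR hK ho
  have hlyap := costMatrix_eq hK
  have hmom := stateMoment_eq hK (secondMoment μ)
  have hYpd := stateMoment_posDef hK hX
  set N := S.costMatrix K * S.closedLoop K * S.stateMoment K (secondMoment μ) with hN
  set X := secondMoment μ
  set PP := S.costMatrix K
  set YY := S.stateMoment K X
  set P := PP.toBlocks₂₂ with hP
  have hPu : IsUnit P.det := (Matrix.isUnit_iff_isUnit_det _).1 hP22.isUnit
  have hPPt : PPᵀ = PP := by simpa using hPsd.isHermitian.eq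
  have hYYt : YYᵀ = YY := by simpa using hYpd.isHermitian.eq
  have hPt : Pᵀ = P := by simpa using hP22.isHermitian.eq
  -- the change of coordinates coming from the cost matrix
  obtain ⟨T, hT⟩ : ∃ T, PP.toBlocks₂₁ = -(P * T) :=
    ⟨-(P⁻¹ * PP.toBlocks₂₁), by
      rw [Matrix.mul_neg, neg_neg, Matrix.mul_nonsing_inv_cancel_left _ _ hPu]⟩
  have hP12 : PP.toBlocks₁₂ = -(Tᵀ * P) := by
    have h1 : PP.toBlocks₁₂ = PP.toBlocks₂₁ᵀ := by
      ext i j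
      exact (congrFun (congrFun hPPt (Sum.inl i)) (Sum.inr j)).symm
    rw [h1, hT, Matrix.transpose_neg, Matrix.transpose_mul, hPt]
  obtain ⟨Pi, hPi⟩ : ∃ Pi, PP.toBlocks₁₁ = Pi + Tᵀ * P * T :=
    ⟨PP.toBlocks₁₁ - Tᵀ * P * T, by rw [sub_add_cancel]⟩
  have hPP : PP = Matrix.fromBlocks (Pi + Tᵀ * P * T) (-(Tᵀ * P)) (-(P * T)) P := by
    rw [← hPi, ← hP12, ← hT, hP, Matrix.fromBlocks_toBlocks]
  -- `Pi` is the restriction of the cost form to the graph `ξ = T x`.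
  have hPipsd : Pi.PosSemidef := by
    have h1 := hPsd.conjTranspose_mul_mul_same
      (Matrix.fromRows (1 : Matrix (Fin n) (Fin n) ℝ) T)
    have h2 : (Matrix.fromRows (1 : Matrix (Fin n) (Fin n) ℝ) T)ᴴ * PP *
        Matrix.fromRows (1 : Matrix (Fin n) (Fin n) ℝ) T = Pi := by
      rw [hPP, Matrix.conjTranspose_fromRows_eq_fromCols_conjTranspose,
        Matrix.mul_assoc, Matrix.fromBlocks_mul_fromRows, Matrix.fromCols_mul_fromRows]
      simp
    rwa [h2] at h1
  have hPit : Piᵀ = Pi := by simpa using hPipsd.isHermitian.eq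
  -- the change of coordinates coming from the moment matrix
  set Y₂₂ := YY.toBlocks₂₂ with hY22
  have hY22pd : Y₂₂.PosDef := hYpd.submatrix Sum.inr_injective
  have hY22u : IsUnit Y₂₂.det := (Matrix.isUnit_iff_isUnit_det _).1 hY22pd.isUnit
  have hY22t : Y₂₂ᵀ = Y₂₂ := by simpa using hY22pd.isHermitian.eq
  obtain ⟨G, hG⟩ : ∃ G, YY.toBlocks₁₂ = G * Y₂₂ :=
    ⟨YY.toBlocks₁₂ * Y₂₂⁻¹, (Matrix.nonsing_inv_mul_cancel_right _ _ hY22u).symm⟩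
  have hY21 : YY.toBlocks₂₁ = Y₂₂ * Gᵀ := by
    have h1 : YY.toBlocks₂₁ = YY.toBlocks₁₂ᵀ := by
      ext i j
      exact (congrFun (congrFun hYYt (Sum.inr i)) (Sum.inl j)).symm
    rw [h1, hG, Matrix.transpose_mul, hY22t]
  obtain ⟨Y, hY⟩ : ∃ Y, YY.toBlocks₁₁ = Y + G * Y₂₂ * Gᵀ :=
    ⟨YY.toBlocks₁₁ - G * Y₂₂ * Gᵀ, by rw [sub_add_cancel]⟩
  have hYY : YY = Matrix.fromBlocks (Y + G * Y₂₂ * Gᵀ) (G * Y₂₂) (Y₂₂ * Gᵀ) Y₂₂ := by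
    rw [← hY, ← hG, ← hY21, hY22, Matrix.fromBlocks_toBlocks]
  -- `Y` is the accumulated moment of `x - G ξ`.
  have hYpos : Y.PosDef := by
    have h1 := hYpd.mul_mul_conjTranspose_same
      (B := Matrix.fromCols (1 : Matrix (Fin n) (Fin n) ℝ) (-G)) (by
      intro u v huv
      have := congrArg (fun w => w ∘ Sum.inl) huv
      simpa [Matrix.vecMul_fromCols] using this)
    have h2 : Matrix.fromCols (1 : Matrix (Fin n) (Fin n) ℝ) (-G) * YY *
        (Matrix.fromCols (1 : Matrix (Fin n) (Fin n) ℝ) (-G))ᴴ = Y := by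
      rw [hYY, Matrix.conjTranspose_fromCols_eq_fromRows_conjTranspose,
        Matrix.fromCols_mul_fromBlocks, Matrix.fromCols_mul_fromRows]
      simp [Matrix.mul_assoc]
    rwa [h2] at h1
  have hYt : Yᵀ = Y := by simpa using hYpos.isHermitian.eq
  have hCY := Matrix.mul_transpose_posDef_of_rank_eq hC hYpos
  have hCYu := (Matrix.isUnit_iff_isUnit_det _).1 hCY.isUnit
  have hRB : (S.R + S.Bᵀ * Pi * S.B).PosDef :=
    hR.add_posSemidef (by simpa using hPipsd.conjTranspose_mul_mul_same S.B)
  have hRBu := (Matrix.isUnit_iff_isUnit_det _).1 hRB.isUnit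
  obtain ⟨L, hL⟩ : ∃ L, L * (S.C * Y * S.Cᵀ) = S.A * Y * S.Cᵀ :=
    ⟨S.A * Y * S.Cᵀ * (S.C * Y * S.Cᵀ)⁻¹, Matrix.nonsing_inv_mul_cancel_right _ _ hCYu⟩
  obtain ⟨F, hF⟩ : ∃ F, (S.R + S.Bᵀ * Pi * S.B) * F = S.Bᵀ * Pi * S.A :=
    ⟨(S.R + S.Bᵀ * Pi * S.B)⁻¹ * (S.Bᵀ * Pi * S.A),
      Matrix.mul_nonsing_inv_cancel_left _ _ hRBu⟩
  rw [hPP] at hlyap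
  obtain ⟨l11, l21, l22⟩ := lyapunov_blocks hlyap
  rw [hPP, hYY] at hN
  obtain ⟨n12, n21, n22⟩ := gradient_blocks hN
  rw [g22, Matrix.mul_zero, sub_zero] at n12
  rw [g22] at n22
  set Z₁ := K.BK * S.C - T * S.A with hZ₁
  set Z₂ := K.AK - T * S.B * K.CK with hZ₂
  -- stationarity in `A_K`
  have hZ : Z₂ = -(Z₁ * G) := by
    have h1 : (Z₁ * G + Z₂) * Y₂₂ = 0 := by
      rw [← Matrix.nonsing_inv_mul_cancel_left _ ((Z₁ * G + Z₂) * Y₂₂) hPu, Matrix.add_mul,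
        Matrix.mul_assoc Z₁, ← n22, Matrix.mul_zero]
    have h2 : Z₁ * G + Z₂ = 0 := by
      rw [← Matrix.mul_nonsing_inv_cancel_right _ (Z₁ * G + Z₂) hY22u, h1, Matrix.zero_mul]
    exact eq_neg_of_add_eq_zero_right h2
  -- stationarity in `B_K`
  have hBK : K.BK = T * L := by
    have h1 : Z₁ * Y * S.Cᵀ = 0 := by
      rw [n21, hZ, Matrix.mul_assoc] at g21
      rw [← Matrix.nonsing_inv_mul_cancel_left _ (Z₁ * Y * S.Cᵀ) hPu]
      refine Eq.trans ?_ (congrArg (fun M => P⁻¹ * M) g21 |>.trans (Matrix.mul_zero _))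
      congr 2
      simp only [Matrix.mul_add, Matrix.neg_mul, Matrix.mul_assoc]
      rw [add_neg_cancel_right, Matrix.mul_assoc]
    rw [← Matrix.mul_nonsing_inv_cancel_right _ K.BK hCYu,
      ← Matrix.mul_nonsing_inv_cancel_right _ (T * L) hCYu]
    congr 1
    rw [Matrix.mul_assoc T, hL]
    rw [hZ₁] at h1
    simp only [Matrix.sub_mul, sub_eq_zero, Matrix.mul_assoc] at h1 ⊢
    exact h1
  -- stationarity in `C_K`
  have hCK : K.CK = -(F * G) := by
    have h1 : ((S.R + S.Bᵀ * Pi * S.B) * K.CK + S.Bᵀ * Pi * S.A * G) * Y₂₂ = 0 := by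
      rw [← g12, n12]
      simp only [Matrix.mul_add, Matrix.add_mul, Matrix.mul_assoc]
      abel
    have h2 : (S.R + S.Bᵀ * Pi * S.B) * K.CK + S.Bᵀ * Pi * S.A * G = 0 := by
      rw [← Matrix.mul_nonsing_inv_cancel_right _ (_ + _) hY22u, h1, Matrix.zero_mul]
    rw [← hF, Matrix.mul_assoc _ F, ← Matrix.mul_add] at h2
    refine eq_neg_of_add_eq_zero_left ?_
    rw [← Matrix.nonsing_inv_mul_cancel_left _ (K.CK + F * G) hRBu, h2, Matrix.mul_zero]
  have hFG : (S.R + S.Bᵀ * Pi * S.B) * K.CK = -(S.Bᵀ * Pi * S.A * G) := by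
    rw [hCK, Matrix.mul_neg, ← Matrix.mul_assoc, hF]
  -- By `hZ` and `hFG`, the (2,2) Lyapunov block is the (2,1) block times `-G`, that is, `P = P * T
  -- * G`, and `P` is invertible.
  have hTG : T * G = 1 := by
    have h1 : P = P * T * G := by
      rw [← neg_neg (P * T), l21, Matrix.neg_mul]
      conv_lhs => rw [l22, Matrix.mul_assoc, hFG]
      conv_lhs => rw [show Z₂ᵀ * P * Z₂ = -(Z₂ᵀ * P * Z₁ * G) by
        rw [Matrix.mul_assoc _ Z₁, ← Matrix.mul_neg, ← hZ]]
      simp only [Matrix.add_mul, Matrix.mul_neg, Matrix.mul_assoc]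
      abel
    rw [← Matrix.nonsing_inv_mul_cancel_left _ (T * G) hPu, ← Matrix.mul_assoc P, ← h1,
      Matrix.nonsing_inv_mul _ hPu]
  have hGT : G * T = 1 := mul_eq_one_comm.1 hTG
  have hZ1 : Z₁ = -(T * (S.A - L * S.C)) := by
    rw [hZ₁, hBK]
    simp only [Matrix.mul_sub, Matrix.mul_assoc]
    abel
  have hAK : K.AK = T * (S.A - S.B * F - L * S.C) * G := by
    have h1 : K.AK = Z₂ + T * S.B * K.CK := by rw [hZ₂, sub_add_cancel]
    rw [h1, hZ, hZ1, hCK]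
    simp only [Matrix.mul_sub, Matrix.sub_mul, Matrix.neg_mul, Matrix.mul_neg, Matrix.mul_assoc]
    abel
  -- Conjugating the (2,2) Lyapunov block by `T` evaluates `Tᵀ * P * T`; in the (1,1) block the
  -- terms with `Z₁` then cancel.
  have hPieq : Pi = S.Q + S.Aᵀ * Pi * (S.A - S.B * F) := by
    have hCT : K.CK * T = -F := by
      rw [hCK, Matrix.neg_mul, Matrix.mul_assoc, hGT, Matrix.mul_one]
    have hZT : Z₂ * T = -Z₁ := by rw [hZ, Matrix.neg_mul, Matrix.mul_assoc, hGT, Matrix.mul_one]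
    have h1 : Tᵀ * P * T = S.Aᵀ * Pi * S.B * F + Z₁ᵀ * P * Z₁ := by
      have h2 : Tᵀ * P * T = (K.CK * T)ᵀ * ((S.R + S.Bᵀ * Pi * S.B) * (K.CK * T)) +
          (Z₂ * T)ᵀ * P * (Z₂ * T) := by
        conv_lhs => rw [l22]
        simp only [Matrix.transpose_mul, Matrix.mul_add, Matrix.add_mul, Matrix.mul_assoc]
      rw [h2, hCT, hZT]
      have h3 := congrArg Matrix.transpose hF
      have hRBt : (S.R + S.Bᵀ * Pi * S.B)ᵀ = S.R + S.Bᵀ * Pi * S.B := by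
        simpa using hRB.isHermitian.eq
      rw [Matrix.transpose_mul, hRBt] at h3
      simp only [Matrix.transpose_mul, Matrix.transpose_transpose, hPit] at h3
      rw [← Matrix.mul_assoc S.Aᵀ] at h3
      rw [← h3]
      simp only [Matrix.transpose_neg, Matrix.neg_mul, Matrix.mul_neg, neg_neg, Matrix.mul_assoc]
    rw [h1, ← add_assoc, add_left_inj] at l11
    rw [Matrix.mul_sub, ← Matrix.mul_assoc, ← add_sub_assoc, ← l11, add_sub_cancel_right]
  -- invariant subspaces of the closed loop
  have hcl := tendsto_closedLoop_pow hK
  -- The estimation error `x - G ξ` evolves by itself, under `A - L C`.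
  have hrow : Matrix.fromCols (1 : Matrix (Fin n) (Fin n) ℝ) (-G) * S.closedLoop K =
      (S.A - L * S.C) * Matrix.fromCols (1 : Matrix (Fin n) (Fin n) ℝ) (-G) := by
    rw [closedLoop, Matrix.fromCols_mul_fromBlocks, Matrix.mul_fromCols, hAK, hBK, hCK]
    congr 1
    · simp only [Matrix.one_mul, Matrix.mul_one, Matrix.neg_mul]
      rw [← Matrix.mul_assoc G, ← Matrix.mul_assoc G, hGT, Matrix.one_mul, sub_eq_add_neg]
    · simp only [Matrix.one_mul, Matrix.neg_mul]
      rw [← Matrix.mul_assoc G, ← Matrix.mul_assoc G, hGT, Matrix.one_mul]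
      simp only [Matrix.sub_mul, Matrix.mul_neg, Matrix.mul_assoc]
      abel
  -- The graph `ξ = T x`, where the error vanishes, is invariant with dynamics `A - B F`.
  have hcol : S.closedLoop K * Matrix.fromRows (1 : Matrix (Fin n) (Fin n) ℝ) T =
      Matrix.fromRows (1 : Matrix (Fin n) (Fin n) ℝ) T * (S.A - S.B * F) := by
    rw [closedLoop, Matrix.fromBlocks_mul_fromRows, Matrix.fromRows_mul, hAK, hBK, hCK]
    congr 1
    · simp only [Matrix.one_mul, Matrix.mul_one, Matrix.mul_neg, Matrix.neg_mul]
      rw [Matrix.mul_assoc, Matrix.mul_assoc F, hGT, Matrix.mul_one, sub_eq_add_neg]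
    · simp only [Matrix.mul_one]
      rw [Matrix.mul_assoc _ G, hGT, Matrix.mul_one]
      simp only [Matrix.mul_sub, Matrix.mul_assoc]
      abel
  have hstabL : Tendsto (fun t : ℕ => (S.A - L * S.C) ^ t) atTop (𝓝 0) := by
    have h1 : ∀ t : ℕ, (S.A - L * S.C) ^ t =
        Matrix.fromCols (1 : Matrix (Fin n) (Fin n) ℝ) (-G) * S.closedLoop K ^ t *
          Matrix.fromRows (1 : Matrix (Fin n) (Fin n) ℝ) (0 : Matrix (Fin n) (Fin n) ℝ) := by
      intro t
      have h2 : Matrix.fromCols (1 : Matrix (Fin n) (Fin n) ℝ) (-G) * S.closedLoop K ^ t =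
          (S.A - L * S.C) ^ t * Matrix.fromCols (1 : Matrix (Fin n) (Fin n) ℝ) (-G) := by
        induction t with
        | zero => simp
        | succ t ih => rw [pow_succ, ← Matrix.mul_assoc, ih, Matrix.mul_assoc, hrow,
            ← Matrix.mul_assoc, ← pow_succ]
      rw [h2, Matrix.mul_assoc, Matrix.fromCols_mul_fromRows]
      simp
    have hc : Continuous fun M : Matrix (Fin n ⊕ Fin n) (Fin n ⊕ Fin n) ℝ =>
        (Matrix.fromCols (1 : Matrix (Fin n) (Fin n) ℝ) (-G) * M *
          Matrix.fromRows (1 : Matrix (Fin n) (Fin n) ℝ) (0 : Matrix (Fin n) (Fin n) ℝ) : Matrix (Fin n) (Fin n) ℝ) :=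
      (continuous_const.matrix_mul continuous_id).matrix_mul continuous_const
    simpa [Function.comp_def, ← h1] using (hc.tendsto 0).comp hcl
  have hstabF : Tendsto (fun t : ℕ => (S.A - S.B * F) ^ t) atTop (𝓝 0) := by
    have h1 : ∀ t : ℕ, (S.A - S.B * F) ^ t =
        Matrix.fromCols (1 : Matrix (Fin n) (Fin n) ℝ) (0 : Matrix (Fin n) (Fin n) ℝ) * S.closedLoop K ^ t *
          Matrix.fromRows (1 : Matrix (Fin n) (Fin n) ℝ) T := by
      intro t
      have h2 : S.closedLoop K ^ t * Matrix.fromRows (1 : Matrix (Fin n) (Fin n) ℝ) T =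
          Matrix.fromRows (1 : Matrix (Fin n) (Fin n) ℝ) T * (S.A - S.B * F) ^ t := by
        induction t with
        | zero => simp
        | succ t ih => rw [pow_succ', Matrix.mul_assoc, ih, ← Matrix.mul_assoc, hcol,
            Matrix.mul_assoc, ← pow_succ']
      rw [Matrix.mul_assoc, h2, ← Matrix.mul_assoc, Matrix.fromCols_mul_fromRows]
      simp
    have hc : Continuous fun M : Matrix (Fin n ⊕ Fin n) (Fin n ⊕ Fin n) ℝ =>
        (Matrix.fromCols (1 : Matrix (Fin n) (Fin n) ℝ) (0 : Matrix (Fin n) (Fin n) ℝ) * M *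
          Matrix.fromRows (1 : Matrix (Fin n) (Fin n) ℝ) T : Matrix (Fin n) (Fin n) ℝ) :=
      (continuous_const.matrix_mul continuous_id).matrix_mul continuous_const
    simpa [Function.comp_def, ← h1] using (hc.tendsto 0).comp hcl
  -- the filter equation
  have hUY : Matrix.fromCols (1 : Matrix (Fin n) (Fin n) ℝ) (-G) * YY =
    Matrix.fromCols Y (0 : Matrix (Fin n) (Fin n) ℝ) := by
    rw [hYY, Matrix.fromCols_mul_fromBlocks]
    congr 1
    · simp only [Matrix.one_mul, Matrix.neg_mul, Matrix.mul_assoc]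
      rw [add_neg_cancel_right]
    · simp only [Matrix.one_mul, Matrix.neg_mul, add_neg_cancel]
  have hfil : Matrix.fromCols Y (0 : Matrix (Fin n) (Fin n) ℝ) =
      Matrix.fromCols (X.toBlocks₁₁ - G * X.toBlocks₂₁) (X.toBlocks₁₂ - G * X.toBlocks₂₂) +
        (S.A - L * S.C) * (Matrix.fromCols Y (0 : Matrix (Fin n) (Fin n) ℝ) * (S.closedLoop K)ᵀ) := by
    conv_lhs => rw [← hUY, hmom, Matrix.mul_add, ← Matrix.mul_assoc, ← Matrix.mul_assoc, hrow,
      Matrix.mul_assoc (S.A - L * S.C), hUY, Matrix.mul_assoc]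
    congr 1
    conv_lhs => rw [← Matrix.fromBlocks_toBlocks X]
    rw [Matrix.fromCols_mul_fromBlocks]
    simp only [Matrix.one_mul, Matrix.neg_mul, sub_eq_add_neg]
  -- This removes `B_K` from the second block column of `hfil`, which then reads `0 = X₁₂ - G X₂₂`;
  -- the first column is the filter Riccati equation.
  have hAL : (S.A - L * S.C) * Y * S.Cᵀ = 0 := by
    simp only [Matrix.sub_mul, sub_eq_zero]
    rw [← hL]
    simp only [Matrix.mul_assoc]
  rw [closedLoop, Matrix.fromBlocks_transpose, Matrix.fromCols_mul_fromBlocks, Matrix.mul_fromCols,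
    Matrix.zero_mul, add_zero, Matrix.zero_mul, add_zero, Matrix.transpose_mul,
    ← Matrix.mul_assoc Y S.Cᵀ, ← Matrix.mul_assoc _ (Y * S.Cᵀ), ← Matrix.mul_assoc _ Y S.Cᵀ, hAL,
    Matrix.zero_mul, ← Matrix.mul_assoc] at hfil
  have hfil1 : Y = (S.A - L * S.C) * Y * S.Aᵀ + (X.toBlocks₁₁ - G * X.toBlocks₂₁) := by
    ext i j
    simpa [add_comm] using congrFun (congrFun hfil i) (Sum.inl j)
  have hfil2 : G * X.toBlocks₂₂ = X.toBlocks₁₂ := by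
    refine (sub_eq_zero.1 ?_).symm
    ext i j
    simpa using (congrFun (congrFun hfil i) (Sum.inr j)).symm
  exact ⟨G, T, Pi, Y, F, L, hTG, hAK, hBK, hCK, hfil2, hPit, hPieq, hF, hRB.isUnit, hstabF, hYt,
    hfil1, hL, hCY.isUnit, hstabL⟩

/-- A stationary point of the cost that is an observable controller is unique. -/
theorem stationary_observable_unique {S : LQData n m d} (hQ : S.Q.PosSemidef) (hR : S.R.PosDef)
    (hC : S.C.rank = d) {μ : Measure ((Fin n → ℝ) × (Fin n → ℝ))}
    (hμ : MemLp (fun z : (Fin n → ℝ) × (Fin n → ℝ) => z) 2 μ) (hX : (secondMoment μ).PosDef)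
    {K K' : Controller n m d} (hs : K ∈ S.stationary μ) (ho : K ∈ observableControllers n m d)
    (hs' : K' ∈ S.stationary μ) (ho' : K' ∈ observableControllers n m d) : K = K' := by
  obtain ⟨G, T, Pi, Y, F, L, h⟩ := exists_isObserverBased hQ hR hC hμ hX hs ho
  obtain ⟨G', T', Pi', Y', F', L', h'⟩ := exists_isObserverBased hQ hR hC hμ hX hs' ho'
  have hXt := secondMoment_transpose μ
  have hX22 : (secondMoment μ).toBlocks₂₂.PosDef := hX.submatrix Sum.inr_injective
  refine h.unique (by simpa using hQ.isHermitian.eq) (by simpa using hR.isHermitian.eq) ?_ ?_ ?_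
    hX22.isUnit h'
  · ext i j
    exact congrFun (congrFun hXt (Sum.inl i)) (Sum.inl j)
  · ext i j
    exact congrFun (congrFun hXt (Sum.inr i)) (Sum.inl j)
  · ext i j
    exact congrFun (congrFun hXt (Sum.inr i)) (Sum.inr j)

end LQData

end

theorem corollary2 {n m d : ℕ} (S : LQData n m d)
    (hQ : S.Q.PosSemidef) (hR : S.R.PosDef)
    (hAB : IsControllablePair S.A S.B) (hCA : IsObservablePair S.C S.A)
    (hQA : IsObservablePair (psdSqrt S.Q) S.A) (hC : S.C.rank = d)
    (μ : Measure ((Fin n → ℝ) × (Fin n → ℝ))) [IsProbabilityMeasure μ]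
    (hμ : MemLp (fun z : (Fin n → ℝ) × (Fin n → ℝ) => z) 2 μ)
    (hX : (secondMoment μ).PosDef)
    (hopt : ∃ Kopt : Controller n m d,
      S.IsGloballyOptimal μ Kopt ∧ Kopt ∈ observableControllers n m d)
    (α : ℕ → ℝ) (K : ℕ → Controller n m d)
    (hK : ∀ i, K (i + 1) = K i - α i • S.gradCost μ (K i))
    (Klim : Controller n m d) (hlim : Tendsto K atTop (𝓝 Klim))
    (hs : Klim ∈ S.stationary μ) (ho : Klim ∈ observableControllers n m d) :
    S.IsGloballyOptimal μ Klim := by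
  obtain ⟨Kopt, hKopt, hoopt⟩ := hopt
  -- The observable optimum is itself stationary, so the limit is that very controller.
  rw [LQData.stationary_observable_unique hQ hR hC hμ hX hs ho
    ⟨hKopt.1, hKopt.gradCost_eq_zero⟩ hoopt]
  exact hKopt
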